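/- Let $m\ge 1$, $L>0$, $D=\mathrm{diag}\{d_1,\dots,d_m\}$ with $d_1,\dots,d_m>0$, let $B=(1,0,\dots,0)^\top\in\mathbb R^{m}$ and let $Q=(q_{i,j})\in\mathbb R^{m\times m}$ satisfy $q_{i,j}=0$ for $i>j+1$. Let $\gamma_{ij}\in\mathbb R$ with $\gamma_{i1}^2+\gamma_{i2}^2\ne 0$ for $i=1,2$. Consider, for $(t,x)\in[0,\infty)\times(0,L)$, the system with internal control $$z_t=Dz_{xx}+Qz+B\sum_{j=1}^N b_j(x)u_j(t),\quad \gamma_{11}z(t,0)+\gamma_{12}z_x(t,0)=0,\quad \gamma_{21}z(t,L)+\gamma_{22}z_x(t,L)=0,\quad z(0,\cdot)=z^0,$$ with $z(t,x)\in\mathbb R^m$ and $b_1,\dots,b_N\in L^2(0,L)$. Let $\lambda_1<\lambda_2<\cdots$ be the eigenvalues, and $(\varphi_n)_{n\ge1}$ corresponding $L^2$-normalized eigenfunctions, of $\varphi''+\lambda\varphi=0$ on $(0,L)$, $\gamma_{11}\varphi(0)+\gamma_{12}\varphi'(0)=\gamma_{21}\varphi(L)+\gamma_{22}\varphi'(L)=0$.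 Write $\mathrm{Sym}(M)=\frac12(M+M^\top)$. Assume that $q_{2,1},q_{3,2},\dots,q_{m,m-1}\neq 0$, and let $\delta>0$. (a) Let $N\in\mathbb N$ be such that $-\lambda_{N+1}D+\mathrm{Sym}(Q)+\delta I_m\prec0$, and assume that the matrix $\mathcal B_{N\times N}$ with entry $b_{j,n}=\int_0^L b_j\varphi_n\,dx$ in row $n$ and column $j$ is nonsingular. Put $\sigma=\min\{i: d_i=d_j\ \text{for all } j=i,\dots,m\}$, $\bar\sigma=\min\{2\sigma-3,2m-4\}$ and $\bar T_0=I_m$, and let $\bar T_i\in\mathbb R^{m\times m}$, $1\le i\le\bar\sigma$, be matrices whose $(j,k)$ entry vanishes unless $j\le m-1-\lceil i/2\rceil$ and $k\ge j+\lceil i/2\rceil$, and which satisfy $$(I_m-BB^\top)\big(Q\bar T_i-\bar T_iQ+\bar T_{i-1}(D-d_mI_m)\big)=0,\qquad 1\le i\le\bar\sigma .$$ Let $T_n=I_m+\sum_{i=1}^{\bar\sigma}\lambda_n^i\bar T_i$ for $1\le n\le N$ (an empty sum if $\bar\sigma\le0$). Let $P_{-1}\in\mathbb R^{m\times m}$ be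 symmetric positive definite and $J\in\mathbb R^{1\times m}$ with $$\mathrm{Sym}(QP_{-1}+BJ)+(\delta-\lambda_1d_m)P_{-1}\prec0, \qquad(\ast)$$ and put $K_Q=JP_{-1}^{-1}$, $$\bar K_n=B^\top\big((Q-\lambda_nd_mI_m)T_n+T_n(\lambda_nD-Q)\big)+K_QT_n\quad(1\le n\le N),\qquad K=\mathcal B_{N\times N}^{-1}\,\mathrm{blkdiag}\{\bar K_1,\dots,\bar K_N\}.$$ Then the feedback $u(t)=KZ(t)$, where $Z=\mathrm{col}\{z_1,\dots,z_N\}$ and $z_n(t)=\int_0^L z(t,x)\varphi_n(x)\,dx\in\mathbb R^m$, exponentially stabilizes the system with decay rate $\delta$: there is a constant $\ell>0$ such that for every initial state $z^0\in L^2(0,L;\mathbb R^m)$ (in particular for every $z^0\in H^1(0,L;\mathbb R^m)$ satisfying compatibility conditions) every solution of the closed-loop system satisfies $$\|z(t,\cdot)\|_{L^2(0,L;\mathbb R^m)}\le \ell e^{-\delta t}\|z^0\|_{L^2(0,L;\mathbb R^m)},\qquad t\ge0 .$$ Here a solution is a map $z\in C([0,\infty);L^2(0,L;\mathbb R^m))$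 with $z(0)=z^0$ which for each $t>0$ is differentiable at $t$ in $L^2$, has $z(t)\in H^2(0,L;\mathbb R^m)$ satisfying the boundary conditions, and satisfies the equation in $L^2$. (b) The linear matrix inequality $(\ast)$ is always feasible: there exist a symmetric positive definite $P_{-1}$ and a $J$ satisfying it. -/

import Mathlib

open MeasureTheory

noncomputable section

namespace ParabolicStabilization

/-! Coupled one-dimensional parabolic systems with internal control of the first equation only.
Vectors and matrices are indexed by `Fin m` (or `Fin N`), so that the index `0` stands for the
first entry and `⊤ : Fin m` for the last one.  Sequences indexed by the positive integers are
shifted in the same way: `lam 0` is the first eigenvalue, `lam N` the `(N+1)`-st one. -/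

/-- The symmetric part `(M + Mᵀ) / 2` of a square matrix. -/
def symPart {m : ℕ} (M : Matrix (Fin m) (Fin m) ℝ) : Matrix (Fin m) (Fin m) ℝ :=
  (1 / 2 : ℝ) • (M + M.transpose)

/-- Negative definiteness `M ≺ 0` of a symmetric matrix. -/
def NegDef {m : ℕ} (M : Matrix (Fin m) (Fin m) ℝ) : Prop := (-M).PosDef

/-- The control column `B = (1, 0, …, 0)ᵀ`. -/
def colB (m : ℕ) [NeZero m] : Matrix (Fin m) (Fin 1) ℝ :=
  Matrix.of fun i _ => if i = 0 then 1 else 0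

/-- Reaction matrices: all entries below the subdiagonal vanish. -/
def IsReactionMatrix {m : ℕ} (Q : Matrix (Fin m) (Fin m) ℝ) : Prop :=
  ∀ i j : Fin m, (j : ℕ) + 1 < (i : ℕ) → Q i j = 0

/-- The entries `q_{2,1}, q_{3,2}, …, q_{m,m-1}` of the subdiagonal are nonzero. -/
def SubdiagonalNonzero {m : ℕ} (Q : Matrix (Fin m) (Fin m) ℝ) : Prop :=
  ∀ i j : Fin m, (i : ℕ) = (j : ℕ) + 1 → Q i j ≠ 0

/-! ### The Sturm–Liouville problem -/

/-- `φ` is an eigenfunction, for the eigenvalue `μ`, of `φ'' + μ φ = 0` on `(0, L)` with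
`γ₁₁ φ(0) + γ₁₂ φ'(0) = 0` and `γ₂₁ φ(L) + γ₂₂ φ'(L) = 0`.  (Only the values of `φ` on `[0, L]`
matter, derivatives at the end points are one-sided.) -/
def IsEigenfunction (L : ℝ) (γ : Matrix (Fin 2) (Fin 2) ℝ) (μ : ℝ) (φ : ℝ → ℝ) : Prop :=
  (∃ φ' : ℝ → ℝ,
    (∀ x ∈ Set.Icc 0 L, HasDerivWithinAt φ (φ' x) (Set.Icc 0 L) x) ∧
    (∀ x ∈ Set.Icc 0 L, HasDerivWithinAt φ' (-(μ * φ x)) (Set.Icc 0 L) x) ∧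
    γ 0 0 * φ 0 + γ 0 1 * φ' 0 = 0 ∧
    γ 1 0 * φ L + γ 1 1 * φ' L = 0) ∧
  ∃ x ∈ Set.Icc 0 L, φ x ≠ 0

/-- `lam` lists all eigenvalues in increasing order, and `φ n` is an eigenfunction for `lam n`
of unit `L²(0, L)` norm. -/
structure IsEigensystem (L : ℝ) (γ : Matrix (Fin 2) (Fin 2) ℝ) (lam : ℕ → ℝ) (φ : ℕ → ℝ → ℝ) :
    Prop where
  strictMono : StrictMono lam
  eigenfunction : ∀ n, IsEigenfunction L γ (lam n) (φ n)
  normalized : ∀ n, ∫ x in (0 : ℝ)..L, φ n x ^ 2 = 1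
  exhaustive : ∀ (μ : ℝ) (ψ : ℝ → ℝ), IsEigenfunction L γ μ ψ → ∃ n, lam n = μ

/-! ### The controlled parabolic system -/

/-- The state space `L²(0, L; ℝᵐ)`, with its norm `(∫₀ᴸ |f(x)|² dx)^{1/2}`. -/
abbrev StateSpace (m : ℕ) (L : ℝ) : Type :=
  Lp (EuclideanSpace ℝ (Fin m)) 2 (volume.restrict (Set.Ioo 0 L))

/-- `f` belongs to `H²(0, L; ℝᵐ)`, satisfies the boundary conditions
`γ₁₁ f(0) + γ₁₂ f'(0) = 0` and `γ₂₁ f(L) + γ₂₂ f'(L) = 0`, and `g` is its second derivative: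
`f` has a representative `v` that is the primitive of a function `v₁`, and `v₁` is a primitive
of `g ∈ L²`. -/
def HasSecondDerivBC {m : ℕ} {L : ℝ} (γ : Matrix (Fin 2) (Fin 2) ℝ) (f g : StateSpace m L) :
    Prop :=
  ∃ v v₁ : ℝ → EuclideanSpace ℝ (Fin m),
    (∀ᵐ x ∂(volume.restrict (Set.Ioo 0 L)), f x = v x) ∧
    (∀ x ∈ Set.Icc 0 L, v x = v 0 + ∫ y in (0 : ℝ)..x, v₁ y) ∧
    (∀ x ∈ Set.Icc 0 L, v₁ x = v₁ 0 + ∫ y in (0 : ℝ)..x, g y) ∧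
    γ 0 0 • v 0 + γ 0 1 • v₁ 0 = 0 ∧
    γ 1 0 • v L + γ 1 1 • v₁ L = 0

/-- `z` solves `z_t = D z_xx + Q z + B ∑ⱼ bⱼ(x) uⱼ(t)`, `D = diag d`, with the homogeneous
boundary conditions given by `γ` and the initial state `z⁰`: it is continuous on `[0, ∞)` with
values in `L²(0, L; ℝᵐ)`, and for every `t > 0` it is differentiable at `t` in `L²`, the state
`z(t)` lies in `H²` and satisfies the boundary conditions, and the equation holds in `L²`. -/
structure IsSolution {m N : ℕ} [NeZero m] {L : ℝ} (γ : Matrix (Fin 2) (Fin 2) ℝ)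
    (d : Fin m → ℝ) (Q : Matrix (Fin m) (Fin m) ℝ) (b : Fin N → ℝ → ℝ) (u : ℝ → Fin N → ℝ)
    (z₀ : StateSpace m L) (z : ℝ → StateSpace m L) : Prop where
  continuousOn : ContinuousOn z (Set.Ici 0)
  initial : z 0 = z₀
  equation : ∀ t, 0 < t → ∃ zt zxx : StateSpace m L,
    HasDerivAt z zt t ∧ HasSecondDerivBC γ (z t) zxx ∧
    ∀ᵐ x ∂(volume.restrict (Set.Ioo 0 L)), ∀ i : Fin m,
      zt x i = d i * zxx x i + ∑ k, Q i k * z t x k + colB m i 0 * ∑ j, b j x * u t j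

/-- The vector `Z = col{z₁, …, z_N}` of the first `N` modes, with entries
`z_{i,n} = ∫₀ᴸ z_i(x) φ_n(x) dx`. -/
def modes {m : ℕ} {L : ℝ} (N : ℕ) (φ : ℕ → ℝ → ℝ) (f : StateSpace m L) : Fin N × Fin m → ℝ :=
  fun p => ∫ x in (0 : ℝ)..L, f x p.2 * φ p.1 x

/-- The `N × N` matrix with entry `b_{j,n} = ∫₀ᴸ b_j(x) φ_n(x) dx` in row `n`, column `j`. -/
def projMatrix {N : ℕ} (L : ℝ) (φ : ℕ → ℝ → ℝ) (b : Fin N → ℝ → ℝ) :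
    Matrix (Fin N) (Fin N) ℝ :=
  Matrix.of fun n j => ∫ x in (0 : ℝ)..L, b j x * φ n x

/-! ### The feedback gain -/

/-- `σ = min {i : d_i = d_j for all j = i, …, m}`, where `i` runs through `1, …, m`. -/
def sigma {m : ℕ} (d : Fin m → ℝ) : ℕ :=
  sInf {i : ℕ | ∃ p : Fin m, (p : ℕ) + 1 = i ∧ ∀ j : Fin m, p ≤ j → d p = d j}

/-- `σ̄ = min {2σ - 3, 2m - 4}`, read as `0` when that is negative (it is only used as the upper
limit of an index that starts at `1`). -/
def sigmaBar {m : ℕ} (d : Fin m → ℝ) : ℕ := min (2 * sigma d - 3) (2 * m - 4)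

/-- The nilpotent shape of the `i`-th matrix: in one-based indices, the entry `(j, k)` may be
nonzero only if `j ≤ m - 1 - ⌈i/2⌉` and `k ≥ j + ⌈i/2⌉`. -/
def HasShape {m : ℕ} (i : ℕ) (M : Matrix (Fin m) (Fin m) ℝ) : Prop :=
  ∀ j k : Fin m,
    ¬ (((j : ℕ) + 1) + (i + 1) / 2 + 1 ≤ m ∧ ((j : ℕ) + 1) + (i + 1) / 2 ≤ (k : ℕ) + 1) →
      M j k = 0

/-- The matrices `T̄₁, …, T̄_σ̄` have the nilpotent shape and satisfy, with `T̄₀ = I`,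
`(I - B Bᵀ) (Q T̄ᵢ - T̄ᵢ Q + T̄ᵢ₋₁ (D - d_m I)) = 0`. -/
structure SolvesSylvester {m : ℕ} [NeZero m] (d : Fin m → ℝ) (Q : Matrix (Fin m) (Fin m) ℝ)
    (Tbar : ℕ → Matrix (Fin m) (Fin m) ℝ) : Prop where
  zero : Tbar 0 = 1
  shape : ∀ i ∈ Finset.Icc 1 (sigmaBar d), HasShape i (Tbar i)
  sylvester : ∀ i ∈ Finset.Icc 1 (sigmaBar d),
    (1 - colB m * (colB m).transpose) *
      (Q * Tbar i - Tbar i * Q + Tbar (i - 1) * (Matrix.diagonal d - d ⊤ • 1)) = 0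

/-- `T = I + ∑_{i=1}^{σ̄} μⁱ T̄ᵢ`, to be taken at `μ = λ_n`. -/
def transf {m : ℕ} (d : Fin m → ℝ) (Tbar : ℕ → Matrix (Fin m) (Fin m) ℝ) (μ : ℝ) :
    Matrix (Fin m) (Fin m) ℝ :=
  1 + ∑ i ∈ Finset.Icc 1 (sigmaBar d), μ ^ i • Tbar i

/-- The row `K̄ = Bᵀ ((Q - μ d_m I) T + T (μ D - Q)) + K_Q T`, to be taken at `μ = λ_n`. -/
def modeGain {m : ℕ} [NeZero m] (d : Fin m → ℝ) (Q : Matrix (Fin m) (Fin m) ℝ)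
    (Tbar : ℕ → Matrix (Fin m) (Fin m) ℝ) (KQ : Matrix (Fin 1) (Fin m) ℝ) (μ : ℝ) :
    Matrix (Fin 1) (Fin m) ℝ :=
  (colB m).transpose * ((Q - (μ * d ⊤) • 1) * transf d Tbar μ
      + transf d Tbar μ * (μ • Matrix.diagonal d - Q))
    + KQ * transf d Tbar μ

/-- `blkdiag{K̄₁, …, K̄_N}` for rows `K̄ₙ` of length `m`. -/
def blkdiagRows {m N : ℕ} (Kbar : Fin N → Matrix (Fin 1) (Fin m) ℝ) :
    Matrix (Fin N) (Fin N × Fin m) ℝ :=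
  Matrix.of fun n p => if p.1 = n then Kbar n 0 p.2 else 0

/-- The feedback gain `K = 𝓑⁻¹ blkdiag{K̄₁, …, K̄_N}`. -/
def gain {m N : ℕ} [NeZero m] (L : ℝ) (d : Fin m → ℝ) (Q : Matrix (Fin m) (Fin m) ℝ)
    (lam : ℕ → ℝ) (φ : ℕ → ℝ → ℝ) (b : Fin N → ℝ → ℝ)
    (Tbar : ℕ → Matrix (Fin m) (Fin m) ℝ) (KQ : Matrix (Fin 1) (Fin m) ℝ) :
    Matrix (Fin N) (Fin N × Fin m) ℝ :=
  (projMatrix L φ b)⁻¹ * blkdiagRows fun n => modeGain d Q Tbar KQ (lam n)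

/-- The linear matrix inequality `Sym(Q P₋₁ + B J) + (δ - λ₁ d_m) P₋₁ ≺ 0`. -/
def DesignLMI {m : ℕ} [NeZero m] (d : Fin m → ℝ) (Q : Matrix (Fin m) (Fin m) ℝ) (δ lam₁ : ℝ)
    (P : Matrix (Fin m) (Fin m) ℝ) (J : Matrix (Fin 1) (Fin m) ℝ) : Prop :=
  NegDef (symPart (Q * P + colB m * J) + (δ - lam₁ * d ⊤) • P)

end ParabolicStabilization

end

/-!
The closed loop is analysed mode by mode, and the proof rests on the fact that the eigenfunctions
`φ n` form a Hilbert basis of `L²(0, L)` (`IsEigensystem.exists_hilbertBasis`).  Below the smallest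
eigenvalue the Sturm–Liouville operator has an explicit inverse, given by variation of constants.
This Green operator is symmetric by Green's identity and compact by the Arzelà–Ascoli theorem, its
kernel is trivial and its eigenvectors are Sturm–Liouville eigenfunctions, so the spectral theorem
for compact symmetric operators yields completeness.

By Green's identity again, the coefficients `zₙ` of a solution obey the ordinary differential
equations `zₙ' = (Q - λₙ D) zₙ + B βₙ`, where `βₙ` is the `n`-th coefficient of `∑ⱼ bⱼ uⱼ`
(`IsSolution.exists_hasDerivAt`).

* Low modes, `n` among the first `N`: the gain makes `βₙ = K̄ₙ zₙ`.  The Sylvester equations for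
  the matrices `T̄ᵢ`, multiplied by `λₙⁱ` and summed, telescope, and the shape of the last matrix
  ends the recursion.  Hence the unipotent matrix `Tₙ` conjugates `Q - λₙ D + B K̄ₙ` into
  `Q - λₙ d_m I + B K_Q` (`SolvesSylvester.transf_mul_closedLoop`).  For this matrix `P₋₁⁻¹` is a
  Lyapunov matrix with rate `δ`, because `λₙ ≥ λ₁` and `d_m > 0`.
* High modes: the energy `W = ‖z‖² - ∑ |zₙ|²`, the sum running over the low modes, is
  differentiated in `L²` and its derivative is expanded by Parseval's identity into a series over
  the high modes only.  Since `λₙ` is at least `λ_{N+1}` there, the spectral gap condition gives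
  `W' ≤ -(2δ + ε) W + C ‖∑ⱼ bⱼ uⱼ‖²` with `ε > 0`.  The control is a function of the low modes, so
  the forcing is of order `e^{-2δt}`, and the margin `ε` gives the rate `δ`
  (`exists_closedLoop_decay`).

The design inequality is feasible by induction on the size of `Q` (`exists_designLMI`).  By a
Finsler argument it suffices that the quadratic form of `(Q + c I) P` is negative on `{x₁ = 0}`.
There only the lower right blocks and the first row of `P` enter; as `q_{2,1} ≠ 0`, that row acts as
a control for the smaller Hessenberg matrix, while the corner entry of `P` remains free to make `P`
positive definite.
-/

noncomputable section

namespace ParabolicStabilization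

/-! ### Primitives of integrable functions -/

/-- On `[0, L]` the function `F` is a primitive of the integrable function `f`.  Outside `[0, L]`
nothing is required. -/
structure IsPrimitive (L : ℝ) (F f : ℝ → ℝ) : Prop where
  intervalIntegrable : IntervalIntegrable f volume 0 L
  eq_add_integral : ∀ x ∈ Set.Icc 0 L, F x = F 0 + ∫ y in (0 : ℝ)..x, f y

namespace IsPrimitive

variable {L : ℝ} {F G f g : ℝ → ℝ}

lemma intervalIntegrable_left (hF : IsPrimitive L F f) {x : ℝ} (hx : x ∈ Set.Icc 0 L) :
    IntervalIntegrable f volume 0 x :=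
  hF.intervalIntegrable.mono_set (by
    rw [Set.uIcc_of_le hx.1, Set.uIcc_of_le (hx.1.trans hx.2)]
    exact Set.Icc_subset_Icc le_rfl hx.2)

lemma continuousOn (hF : IsPrimitive L F f) : ContinuousOn F (Set.Icc 0 L) := by
  by_cases hL : 0 ≤ L
  · have h := (intervalIntegrable_iff' (by simp)).1 hF.intervalIntegrable
    have h2 := intervalIntegral.continuousOn_primitive_interval h
    rw [Set.uIcc_of_le hL] at h2
    exact (h2.const_add (F 0)).congr hF.eq_add_integral
  · simp [Set.Icc_eq_empty hL]

lemma const (L c : ℝ) : IsPrimitive L (fun _ => c) (fun _ => 0) :=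
  ⟨by simp, by simp⟩

lemma integral (hf : IntervalIntegrable f volume 0 L) :
    IsPrimitive L (fun x => ∫ y in (0 : ℝ)..x, f y) f :=
  ⟨hf, by simp⟩

lemma const_mul (hF : IsPrimitive L F f) (c : ℝ) :
    IsPrimitive L (fun x => c * F x) (fun x => c * f x) := by
  refine ⟨hF.intervalIntegrable.const_mul c, fun x hx => ?_⟩
  rw [hF.eq_add_integral x hx, intervalIntegral.integral_const_mul]
  ring

lemma add (hF : IsPrimitive L F f) (hG : IsPrimitive L G g) :
    IsPrimitive L (fun x => F x + G x) (fun x => f x + g x) := by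
  refine ⟨hF.intervalIntegrable.add hG.intervalIntegrable, fun x hx => ?_⟩
  rw [hF.eq_add_integral x hx, hG.eq_add_integral x hx,
    intervalIntegral.integral_add (hF.intervalIntegrable_left hx) (hG.intervalIntegrable_left hx)]
  ring

lemma congr_ae (hL : 0 ≤ L) (hF : IsPrimitive L F f)
    (h : ∀ᵐ x ∂(volume.restrict (Set.Ioo 0 L)), f x = g x) : IsPrimitive L F g := by
  rw [← Measure.restrict_congr_set Ioo_ae_eq_Ioc.symm, ae_restrict_iff' measurableSet_Ioc] at h
  refine ⟨hF.intervalIntegrable.congr_ae ?_, fun x hx => ?_⟩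
  · rw [Set.uIoc_of_le hL, Filter.EventuallyEq, ae_restrict_iff' measurableSet_Ioc]
    exact h
  · rw [hF.eq_add_integral x hx]
    congr 1
    apply intervalIntegral.integral_congr_ae
    filter_upwards [h] with y hy hyx
    rw [Set.uIoc_of_le hx.1] at hyx
    exact hy ⟨hyx.1, hyx.2.trans hx.2⟩

/-- The product rule for absolutely continuous functions, in integrated form. -/
lemma mul (hL : 0 ≤ L) (hF : IsPrimitive L F f) (hG : IsPrimitive L G g) :
    IsPrimitive L (fun x => F x * G x) (fun x => f x * G x + F x * g x) := by
  have hcF := hF.continuousOn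
  have hcG := hG.continuousOn
  rw [← Set.uIcc_of_le hL] at hcF hcG
  refine ⟨(hF.intervalIntegrable.mul_continuousOn hcG).add
    (hG.intervalIntegrable.continuousOn_mul hcF), fun x hx => ?_⟩
  have hf := hF.intervalIntegrable_left hx
  have hg := hG.intervalIntegrable_left hx
  have h0x : (0 : ℝ) ∈ Set.uIcc 0 x := by simp
  -- The equation only holds on `[0, L]`, so it is the right-hand sides that are differentiated.
  have acF : AbsolutelyContinuousOnInterval (fun t => F 0 + ∫ y in (0 : ℝ)..t, f y) 0 x :=
    (LipschitzOnWith.absolutelyContinuousOnInterval (K := 0)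
      (LipschitzWith.const (F 0)).lipschitzOnWith).add
      (hf.absolutelyContinuousOnInterval_intervalIntegral h0x)
  have acG : AbsolutelyContinuousOnInterval (fun t => G 0 + ∫ y in (0 : ℝ)..t, g y) 0 x :=
    (LipschitzOnWith.absolutelyContinuousOnInterval (K := 0)
      (LipschitzWith.const (G 0)).lipschitzOnWith).add
      (hg.absolutelyContinuousOnInterval_intervalIntegral h0x)
  have key := acF.integral_deriv_mul_eq_sub acG
  simp only [intervalIntegral.integral_same, add_zero] at key
  rw [← hF.eq_add_integral x hx, ← hG.eq_add_integral x hx] at key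
  have : ∫ y in (0 : ℝ)..x, (f y * G y + F y * g y) = F x * G x - F 0 * G 0 := by
    rw [← key]
    apply intervalIntegral.integral_congr_ae
    filter_upwards [hf.ae_hasDerivAt_integral, hg.ae_hasDerivAt_integral] with y h1 h2 hy
    have hy' := Set.uIoc_subset_uIcc hy
    rw [((h1 hy' 0 h0x).const_add (F 0)).deriv, ((h2 hy' 0 h0x).const_add (G 0)).deriv]
    rw [Set.uIcc_of_le hx.1] at hy'
    have hyL : y ∈ Set.Icc 0 L := ⟨hy'.1, hy'.2.trans hx.2⟩
    rw [← hF.eq_add_integral y hyL, ← hG.eq_add_integral y hyL]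
  rw [this]
  ring

lemma of_hasDerivWithinAt (hL : 0 ≤ L)
    (h : ∀ x ∈ Set.Icc 0 L, HasDerivWithinAt F (f x) (Set.Icc 0 L) x)
    (hf : ContinuousOn f (Set.Icc 0 L)) : IsPrimitive L F f := by
  have hi : IntervalIntegrable f volume 0 L :=
    ContinuousOn.intervalIntegrable (by rwa [Set.uIcc_of_le hL])
  refine ⟨hi, fun x hx => ?_⟩
  rw [intervalIntegral.integral_eq_sub_of_hasDeriv_right (f := F)]
  · ring
  · rw [Set.uIcc_of_le hx.1]
    exact fun y hy => ((h y ⟨hy.1, hy.2.trans hx.2⟩).continuousWithinAt).mono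
      (Set.Icc_subset_Icc le_rfl hx.2)
  · intro y hy
    rw [min_eq_left hx.1, max_eq_right hx.1] at hy
    have hy' : y ∈ Set.Ioo 0 L := ⟨hy.1, hy.2.trans_le hx.2⟩
    exact ((h y ⟨hy'.1.le, hy'.2.le⟩).hasDerivAt (Icc_mem_nhds hy'.1 hy'.2)).hasDerivWithinAt
  · exact hi.mono_set (by
      rw [Set.uIcc_of_le hx.1, Set.uIcc_of_le hL]
      exact Set.Icc_subset_Icc le_rfl hx.2)

lemma hasDerivWithinAt (hF : IsPrimitive L F f) (hf : ContinuousOn f (Set.Icc 0 L))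
    {x : ℝ} (hx : x ∈ Set.Icc 0 L) : HasDerivWithinAt F (f x) (Set.Icc 0 L) x := by
  have : Fact (x ∈ Set.Icc 0 L) := ⟨hx⟩
  have h := intervalIntegral.integral_hasDerivWithinAt_right (s := Set.Icc 0 L)
    (t := Set.Icc 0 L) (hF.intervalIntegrable_left hx)
    (hf.stronglyMeasurableAtFilter_nhdsWithin measurableSet_Icc x) (hf x hx)
  exact (h.const_add (F 0)).congr hF.eq_add_integral (hF.eq_add_integral x hx)

end IsPrimitive

/-! ### The Sturm–Liouville boundary value problem -/

/-- `v` belongs to the domain of the Sturm–Liouville operator: `v₁` and `g` are its first and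
second derivatives (the latter merely integrable) and `v` satisfies the boundary conditions. -/
structure IsDomainFunction (L : ℝ) (γ : Matrix (Fin 2) (Fin 2) ℝ) (v v₁ g : ℝ → ℝ) : Prop where
  deriv : IsPrimitive L v v₁
  deriv₂ : IsPrimitive L v₁ g
  left : γ 0 0 * v 0 + γ 0 1 * v₁ 0 = 0
  right : γ 1 0 * v L + γ 1 1 * v₁ L = 0

/-- Two vectors annihilated by the same nonzero covector are proportional. -/
lemma cross_eq_of_annihilated {p q a a' b b' : ℝ} (h : p ^ 2 + q ^ 2 ≠ 0)
    (ha : p * a + q * a' = 0) (hb : p * b + q * b' = 0) : a' * b = a * b' := by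
  have h1 : (p ^ 2 + q ^ 2) * (a' * b - a * b') = 0 := by
    linear_combination (p * b' - q * b) * (-ha) + (p * a' - q * a) * hb
  rcases mul_eq_zero.1 h1 with h2 | h2
  · exact absurd h2 h
  · linarith

section Operator

variable {L : ℝ} {γ : Matrix (Fin 2) (Fin 2) ℝ}

/-- Green's identity: the second derivative is symmetric under the boundary conditions. -/
lemma IsDomainFunction.integral_symm (hL : 0 ≤ L) (hγ : ∀ i, γ i 0 ^ 2 + γ i 1 ^ 2 ≠ 0)
    {v v₁ g w w₁ h : ℝ → ℝ} (hv : IsDomainFunction L γ v v₁ g)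
    (hw : IsDomainFunction L γ w w₁ h) :
    ∫ x in (0 : ℝ)..L, g x * w x = ∫ x in (0 : ℝ)..L, v x * h x := by
  have hLm : L ∈ Set.Icc 0 L := ⟨hL, le_rfl⟩
  have e1 := (hv.deriv₂.mul hL hw.deriv).eq_add_integral L hLm
  have e2 := (hv.deriv.mul hL hw.deriv₂).eq_add_integral L hLm
  have c : ∀ {F f : ℝ → ℝ}, IsPrimitive L F f → ContinuousOn F (Set.uIcc 0 L) := by
    intro F f hF
    rw [Set.uIcc_of_le hL]
    exact hF.continuousOn
  have i1 : IntervalIntegrable (fun x => g x * w x) volume 0 L :=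
    hv.deriv₂.intervalIntegrable.mul_continuousOn (c hw.deriv)
  have i2 : IntervalIntegrable (fun x => v₁ x * w₁ x) volume 0 L :=
    hv.deriv.intervalIntegrable.mul_continuousOn (c hw.deriv₂)
  have i3 : IntervalIntegrable (fun x => v x * h x) volume 0 L :=
    hw.deriv₂.intervalIntegrable.continuousOn_mul (c hv.deriv)
  rw [intervalIntegral.integral_add i1 i2] at e1
  rw [intervalIntegral.integral_add i2 i3] at e2
  have b0 := cross_eq_of_annihilated (hγ 0) hv.left hw.left
  have bL := cross_eq_of_annihilated (hγ 1) hv.right hw.right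
  linarith

lemma IsEigenfunction.exists_isDomainFunction (hL : 0 ≤ L) {μ : ℝ} {φ : ℝ → ℝ}
    (h : IsEigenfunction L γ μ φ) :
    ∃ φ', IsDomainFunction L γ φ φ' (fun x => -(μ * φ x)) := by
  obtain ⟨⟨φ', h1, h2, h3, h4⟩, -⟩ := h
  exact ⟨φ', .of_hasDerivWithinAt hL h1 fun x hx => (h2 x hx).continuousWithinAt,
    .of_hasDerivWithinAt hL h2 fun x hx =>
      ((h1 x hx).continuousWithinAt.const_mul μ).neg, h3, h4⟩

lemma IsDomainFunction.isEigenfunction {μ : ℝ} {φ φ' : ℝ → ℝ}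
    (h : IsDomainFunction L γ φ φ' (fun x => -(μ * φ x))) (hne : ∃ x ∈ Set.Icc 0 L, φ x ≠ 0) :
    IsEigenfunction L γ μ φ :=
  ⟨⟨φ', fun _ hx => h.deriv.hasDerivWithinAt h.deriv₂.continuousOn hx,
    fun _ hx => h.deriv₂.hasDerivWithinAt (h.deriv.continuousOn.const_mul μ).neg hx,
    h.left, h.right⟩, hne⟩

lemma IsEigenfunction.continuousOn {μ : ℝ} {φ : ℝ → ℝ} (h : IsEigenfunction L γ μ φ) :
    ContinuousOn φ (Set.Icc 0 L) := by
  obtain ⟨⟨φ', h1, -⟩, -⟩ := h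
  exact fun x hx => (h1 x hx).continuousWithinAt

/-- Uniqueness for the linear initial value problem `χ'' = -μ χ`, `χ(0) = χ'(0) = 0`. -/
lemma eq_zero_of_initial_eq_zero {μ : ℝ} {χ χ' : ℝ → ℝ}
    (h1 : ∀ x ∈ Set.Icc 0 L, HasDerivWithinAt χ (χ' x) (Set.Icc 0 L) x)
    (h2 : ∀ x ∈ Set.Icc 0 L, HasDerivWithinAt χ' (-(μ * χ x)) (Set.Icc 0 L) x)
    (h0 : χ 0 = 0) (h0' : χ' 0 = 0) : ∀ x ∈ Set.Icc 0 L, χ x = 0 := by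
  let A : ℝ × ℝ →L[ℝ] ℝ × ℝ :=
    (ContinuousLinearMap.snd ℝ ℝ ℝ).prod (-(μ • ContinuousLinearMap.fst ℝ ℝ ℝ))
  have key : Set.EqOn (fun x => (χ x, χ' x)) (fun _ => (0, 0)) (Set.Icc 0 L) := by
    refine ODE_solution_unique (v := fun _ => A) (fun _ => A.lipschitz) ?_ ?_ ?_ ?_ ?_
    · exact fun x hx => (h1 x hx).continuousWithinAt.prodMk (h2 x hx).continuousWithinAt
    · intro x hx
      have hx' : x ∈ Set.Icc 0 L := ⟨hx.1, hx.2.le⟩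
      exact ((h1 x hx').prodMk (h2 x hx')).mono_of_mem_nhdsWithin (Icc_mem_nhdsGE_of_mem hx)
    · exact continuousOn_const
    · intro x hx
      exact (hasDerivWithinAt_const x (Set.Ici x) ((0, 0) : ℝ × ℝ)).congr_deriv (map_zero A).symm
    · simp [h0, h0']
  intro x hx
  exact congrArg Prod.fst (key hx)

/-- Eigenvalues are simple: their eigenfunctions have proportional Cauchy data at `0`. -/
lemma IsEigenfunction.exists_eq_const_mul (hγ : ∀ i, γ i 0 ^ 2 + γ i 1 ^ 2 ≠ 0)
    {μ : ℝ} {φ ψ : ℝ → ℝ} (hφ : IsEigenfunction L γ μ φ) (hψ : IsEigenfunction L γ μ ψ) :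
    ∃ c : ℝ, ∀ x ∈ Set.Icc 0 L, ψ x = c * φ x := by
  obtain ⟨⟨φ', p1, p2, p3, -⟩, x₀, hx₀, hne⟩ := hφ
  obtain ⟨⟨ψ', q1, q2, q3, -⟩, -⟩ := hψ
  have hcr := cross_eq_of_annihilated (hγ 0) p3 q3
  obtain ⟨c, hc, hc'⟩ : ∃ c : ℝ, ψ 0 = c * φ 0 ∧ ψ' 0 = c * φ' 0 := by
    by_cases h0 : φ 0 = 0
    · have h0' : φ' 0 ≠ 0 := fun h => hne (eq_zero_of_initial_eq_zero p1 p2 h0 h x₀ hx₀)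
      refine ⟨ψ' 0 / φ' 0, ?_, by field_simp⟩
      rw [h0, zero_mul] at hcr
      simpa [h0, h0'] using hcr
    · refine ⟨ψ 0 / φ 0, by field_simp, ?_⟩
      field_simp
      linarith
  refine ⟨c, fun x hx => ?_⟩
  have := eq_zero_of_initial_eq_zero (L := L) (μ := μ) (χ := fun x => ψ x - c * φ x)
    (χ' := fun x => ψ' x - c * φ' x) (fun x hx => (q1 x hx).sub ((p1 x hx).const_mul c))
    (fun x hx => ((q2 x hx).sub ((p2 x hx).const_mul c)).congr_deriv (by ring))
    (by simp [hc]) (by simp [hc']) x hx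
  simpa [sub_eq_zero] using this

end Operator

/-! ### The Green operator -/

/-- The scalar space `L²(0, L)`. -/
abbrev ScalarSpace (L : ℝ) : Type := Lp ℝ 2 (volume.restrict (Set.Ioo (0 : ℝ) L))

/-- Solutions `u`, `w` of `y'' = κ y` satisfying the left, respectively the right, boundary
condition, with Wronskian `u w' - u' w = -1`. -/
structure IsGreenPair (L : ℝ) (γ : Matrix (Fin 2) (Fin 2) ℝ) (κ : ℝ) (u u' w w' : ℝ → ℝ) :
    Prop where
  deriv_u : ∀ x, HasDerivAt u (u' x) x
  deriv_u' : ∀ x, HasDerivAt u' (κ * u x) x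
  deriv_w : ∀ x, HasDerivAt w (w' x) x
  deriv_w' : ∀ x, HasDerivAt w' (κ * w x) x
  left : γ 0 0 * u 0 + γ 0 1 * u' 0 = 0
  right : γ 1 0 * w L + γ 1 1 * w' L = 0
  wronskian : ∀ x, u x * w' x - u' x * w x = -1

section Green

variable {L : ℝ} {γ : Matrix (Fin 2) (Fin 2) ℝ}

/-- If `-k²` is not an eigenvalue then the two solutions of `y'' = k² y` that satisfy one boundary
condition each are linearly independent. -/
lemma exists_isGreenPair (hL : 0 < L) (hγ : ∀ i, γ i 0 ^ 2 + γ i 1 ^ 2 ≠ 0) {k : ℝ} (hk : k ≠ 0)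
    (hne : ¬ ∃ φ, IsEigenfunction L γ (-k ^ 2) φ) :
    ∃ u u' w w', IsGreenPair L γ (k ^ 2) u u' w w' := by
  let s : ℝ → ℝ → ℝ → ℝ → ℝ := fun p q a x =>
    q * Real.cosh (k * (x - a)) - p * Real.sinh (k * (x - a)) / k
  let s' : ℝ → ℝ → ℝ → ℝ → ℝ :=
    fun p q a x => q * (k * Real.sinh (k * (x - a))) - p * Real.cosh (k * (x - a))
  have lin : ∀ a x : ℝ, HasDerivAt (fun x => k * (x - a)) k x := fun a x => by
    simpa using ((hasDerivAt_id x).sub_const a).const_mul k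
  have hs : ∀ p q a x, HasDerivAt (s p q a) (s' p q a x) x := by
    intro p q a x
    have h1 := ((lin a x).cosh).const_mul q
    have h2 := (((lin a x).sinh).const_mul p).div_const k
    refine (h1.sub h2).congr_deriv ?_
    simp only [s']
    field_simp
  have hs' : ∀ p q a x, HasDerivAt (s' p q a) (k ^ 2 * s p q a x) x := by
    intro p q a x
    have h1 := (((lin a x).sinh).const_mul k).const_mul q
    have h2 := ((lin a x).cosh).const_mul p
    refine (h1.sub h2).congr_deriv ?_
    simp only [s]
    field_simp
  have s0 : ∀ p q a, s p q a a = q := by intro p q a; simp [s]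
  have s0' : ∀ p q a, s' p q a a = -p := by intro p q a; simp [s']
  set u := s (γ 0 0) (γ 0 1) 0 with hu
  set u' := s' (γ 0 0) (γ 0 1) 0 with hu'
  set w := s (γ 1 0) (γ 1 1) L with hw
  set w' := s' (γ 1 0) (γ 1 1) L with hw'
  have hW : ∀ x, HasDerivAt (fun x => u x * w' x - u' x * w x) 0 x := by
    intro x
    refine (((hs _ _ _ x).mul (hs' _ _ _ x)).sub ((hs' _ _ _ x).mul (hs _ _ _ x))).congr_deriv ?_
    ring
  set W := u L * w' L - u' L * w L with hWdef
  have hconst : ∀ x, u x * w' x - u' x * w x = W := fun x =>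
    is_const_of_deriv_eq_zero (fun x => (hW x).differentiableAt) (fun x => (hW x).deriv) x L
  have hW0 : W ≠ 0 := by
    intro h0
    rw [hWdef, hw, hw', s0, s0'] at h0
    refine hne ⟨u, ⟨u', fun x _ => (hs _ _ _ x).hasDerivWithinAt, fun x _ =>
      ((hs' _ _ _ x).congr_deriv (by ring)).hasDerivWithinAt, ?_, by linarith⟩, ?_⟩
    · rw [hu, hu', s0, s0']; ring
    · by_contra! hz
      -- Were `u` zero on `[0, L]`, its Cauchy data `(γ₁₂, -γ₁₁)` at `0` would vanish.
      have h0L : (0 : ℝ) ∈ Set.Icc 0 L := ⟨le_rfl, hL.le⟩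
      have hd : HasDerivWithinAt u 0 (Set.Icc 0 L) 0 :=
        (hasDerivWithinAt_const 0 (Set.Icc 0 L) (0 : ℝ)).congr hz (hz 0 h0L)
      have hu'0 : u' 0 = 0 :=
        (uniqueDiffOn_Icc hL 0 h0L).eq_deriv _ (hs _ _ _ 0).hasDerivWithinAt hd
      have hu0 := hz 0 h0L
      rw [hu, s0] at hu0
      rw [hu', s0'] at hu'0
      exact hγ 0 (by rw [hu0, neg_eq_zero.1 hu'0]; norm_num)
  refine ⟨u, u', fun x => (-1 / W) * w x, fun x => (-1 / W) * w' x, hs _ _ _, hs' _ _ _,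
    fun x => (hs _ _ _ x).const_mul _, fun x => ((hs' _ _ _ x).const_mul _).congr_deriv (by ring),
    ?_, ?_, fun x => ?_⟩
  · rw [hu, hu', s0, s0']; ring
  · rw [hw, hw', s0, s0']; ring
  · have := hconst x
    field_simp
    linarith

/-- The solution of `v'' = κ v - f` with homogeneous boundary conditions, by variation of
constants. -/
def greenSolution (L : ℝ) (u w f : ℝ → ℝ) (x : ℝ) : ℝ :=
  w x * (∫ y in (0 : ℝ)..x, u y * f y) +
    u x * ((∫ y in (0 : ℝ)..L, w y * f y) - ∫ y in (0 : ℝ)..x, w y * f y)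

variable {κ : ℝ} {u u' w w' : ℝ → ℝ}

lemma IsPrimitive.of_hasDerivAt (hL : 0 ≤ L) {F f : ℝ → ℝ}
    (h : ∀ x, HasDerivAt F (f x) x) (hf : Continuous f) : IsPrimitive L F f :=
  .of_hasDerivWithinAt hL (fun x _ => (h x).hasDerivWithinAt) hf.continuousOn

namespace IsGreenPair

lemma continuous_u (h : IsGreenPair L γ κ u u' w w') : Continuous u :=
  continuous_iff_continuousAt.2 fun x => (h.deriv_u x).continuousAt
lemma continuous_u' (h : IsGreenPair L γ κ u u' w w') : Continuous u' :=
  continuous_iff_continuousAt.2 fun x => (h.deriv_u' x).continuousAt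
lemma continuous_w (h : IsGreenPair L γ κ u u' w w') : Continuous w :=
  continuous_iff_continuousAt.2 fun x => (h.deriv_w x).continuousAt
lemma continuous_w' (h : IsGreenPair L γ κ u u' w w') : Continuous w' :=
  continuous_iff_continuousAt.2 fun x => (h.deriv_w' x).continuousAt

/-- The derivative of `greenSolution L u w f` is `greenSolution L u w f` with `u`, `w` replaced
by their derivatives outside the integrals, as the terms from the integrals cancel. -/
lemma isDomainFunction (hL : 0 ≤ L) (h : IsGreenPair L γ κ u u' w w') {f : ℝ → ℝ}
    (hf : IntervalIntegrable f volume 0 L) :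
    IsDomainFunction L γ (greenSolution L u w f)
      (fun x => w' x * (∫ y in (0 : ℝ)..x, u y * f y) +
        u' x * ((∫ y in (0 : ℝ)..L, w y * f y) - ∫ y in (0 : ℝ)..x, w y * f y))
      (fun x => κ * greenSolution L u w f x - f x) := by
  have iu : IntervalIntegrable (fun y => u y * f y) volume 0 L :=
    hf.continuousOn_mul h.continuous_u.continuousOn
  have iw : IntervalIntegrable (fun y => w y * f y) volume 0 L :=
    hf.continuousOn_mul h.continuous_w.continuousOn
  have pA := IsPrimitive.integral iu
  have pC : IsPrimitive L
      (fun x => (∫ y in (0 : ℝ)..L, w y * f y) - ∫ y in (0 : ℝ)..x, w y * f y)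
      (fun y => -(w y * f y)) := by
    have := (IsPrimitive.const L (∫ y in (0 : ℝ)..L, w y * f y)).add
      ((IsPrimitive.integral iw).const_mul (-1))
    simpa [sub_eq_add_neg] using this
  have pu := IsPrimitive.of_hasDerivAt hL h.deriv_u h.continuous_u'
  have pw := IsPrimitive.of_hasDerivAt hL h.deriv_w h.continuous_w'
  have pu' := IsPrimitive.of_hasDerivAt hL h.deriv_u' (h.continuous_u.const_mul κ)
  have pw' := IsPrimitive.of_hasDerivAt hL h.deriv_w' (h.continuous_w.const_mul κ)
  refine ⟨?_, ?_, ?_, ?_⟩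
  · have := (pw.mul hL pA).add (pu.mul hL pC)
    refine this.congr_ae hL (Filter.Eventually.of_forall fun x => ?_)
    ring
  · have := (pw'.mul hL pA).add (pu'.mul hL pC)
    refine this.congr_ae hL (Filter.Eventually.of_forall fun x => ?_)
    simp only [greenSolution]
    linear_combination f x * h.wronskian x
  · simp only [greenSolution, intervalIntegral.integral_same]
    linear_combination (∫ y in (0 : ℝ)..L, w y * f y) * h.left
  · simp only [greenSolution, sub_self]
    linear_combination (∫ y in (0 : ℝ)..L, u y * f y) * h.right

end IsGreenPair

lemma ScalarSpace.intervalIntegrable (hL : 0 ≤ L) (f : ScalarSpace L) :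
    IntervalIntegrable f volume 0 L := by
  rw [intervalIntegrable_iff_integrableOn_Ioo_of_le hL]
  exact (Lp.memLp f).integrable one_le_two

lemma intervalIntegral_eq_integral_Ioo (hL : 0 ≤ L) (f : ℝ → ℝ) :
    ∫ x in (0 : ℝ)..L, f x = ∫ x in Set.Ioo 0 L, f x := by
  rw [intervalIntegral.integral_of_le hL, integral_Ioc_eq_integral_Ioo]

lemma ScalarSpace.inner_eq (hL : 0 ≤ L) (f g : ScalarSpace L) :
    inner ℝ f g = ∫ x in (0 : ℝ)..L, f x * g x := by
  rw [intervalIntegral_eq_integral_Ioo hL, L2.inner_def]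
  simp [mul_comm]

lemma greenSolution_congr_ae (hL : 0 ≤ L) {f g : ℝ → ℝ}
    (h : ∀ᵐ x ∂(volume.restrict (Set.Ioo 0 L)), f x = g x) {x : ℝ} (hx : x ∈ Set.Icc 0 L) :
    greenSolution L u w f x = greenSolution L u w g x := by
  have key : ∀ v : ℝ → ℝ, ∀ y ∈ Set.Icc 0 L,
      ∫ t in (0 : ℝ)..y, v t * f t = ∫ t in (0 : ℝ)..y, v t * g t := by
    intro v y hy
    rw [ae_restrict_iff' measurableSet_Ioo] at h
    rw [intervalIntegral_eq_integral_Ioo hy.1, intervalIntegral_eq_integral_Ioo hy.1]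
    apply integral_congr_ae
    rw [Filter.EventuallyEq, ae_restrict_iff' measurableSet_Ioo]
    filter_upwards [h] with t ht hty
    rw [ht ⟨hty.1, hty.2.trans_le hy.2⟩]
  simp only [greenSolution]
  rw [key u x hx, key w x hx, key w L ⟨hL, le_rfl⟩]

lemma abs_integral_mul_le {v f : ℝ → ℝ} {M I x : ℝ} (hx : x ∈ Set.Icc 0 L)
    (hM : ∀ y ∈ Set.Icc 0 L, |v y| ≤ M) (hf : IntervalIntegrable f volume 0 L)
    (hI : ∫ y in (0 : ℝ)..L, |f y| ≤ I) : |∫ y in (0 : ℝ)..x, v y * f y| ≤ M * I := by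
  have hL : 0 ≤ L := hx.1.trans hx.2
  have hM0 : 0 ≤ M := (abs_nonneg _).trans (hM 0 ⟨le_rfl, hL⟩)
  have hfx : IntervalIntegrable f volume 0 x := (IsPrimitive.integral hf).intervalIntegrable_left hx
  have h2 := intervalIntegral.norm_integral_le_of_norm_le hx.1
    (by
      refine Filter.Eventually.of_forall fun y hy => ?_
      rw [Real.norm_eq_abs, abs_mul]
      exact mul_le_mul_of_nonneg_right (hM y ⟨hy.1.le, hy.2.trans hx.2⟩) (abs_nonneg _))
    (hfx.abs.const_mul M)
  rw [Real.norm_eq_abs, intervalIntegral.integral_const_mul] at h2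
  refine h2.trans (mul_le_mul_of_nonneg_left (le_trans ?_ hI) hM0)
  exact intervalIntegral.integral_mono_interval le_rfl hx.1 hx.2
    (Filter.Eventually.of_forall fun y => abs_nonneg _) hf.abs

/-- The variation of constants formula as a map into the continuous functions on `[0, L]`. -/
def greenToContinuous (hL : 0 ≤ L) (h : IsGreenPair L γ κ u u' w w') :
    ScalarSpace L →ₗ[ℝ] BoundedContinuousFunction (Set.Icc (0 : ℝ) L) ℝ where
  toFun f := BoundedContinuousFunction.mkOfCompact
    ⟨fun x => greenSolution L u w f x, continuousOn_iff_continuous_domRestrict.1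
      (h.isDomainFunction hL (f.intervalIntegrable hL)).deriv.continuousOn⟩
  map_add' f g := by
    ext ⟨x, hx⟩
    have key : ∀ v : ℝ → ℝ, Continuous v → ∀ y ∈ Set.Icc 0 L,
        ∫ t in (0 : ℝ)..y, v t * (f t + g t) =
          (∫ t in (0 : ℝ)..y, v t * f t) + ∫ t in (0 : ℝ)..y, v t * g t := by
      intro v hv y hy
      rw [← intervalIntegral.integral_add]
      · simp only [mul_add]
      · exact ((IsPrimitive.integral (f.intervalIntegrable hL)).intervalIntegrable_left
          hy).continuousOn_mul hv.continuousOn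
      · exact ((IsPrimitive.integral (g.intervalIntegrable hL)).intervalIntegrable_left
          hy).continuousOn_mul hv.continuousOn
    have h1 : greenSolution L u w (f + g : ScalarSpace L) x =
        greenSolution L u w (fun t => f t + g t) x :=
      greenSolution_congr_ae hL (Lp.coeFn_add f g) hx
    change greenSolution L u w (f + g : ScalarSpace L) x =
      greenSolution L u w f x + greenSolution L u w g x
    rw [h1]
    simp only [greenSolution]
    rw [key u h.continuous_u x hx, key w h.continuous_w x hx, key w h.continuous_w L ⟨hL, le_rfl⟩]
    ring
  map_smul' c f := by
    ext ⟨x, hx⟩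
    have h1 : greenSolution L u w (c • f : ScalarSpace L) x =
        greenSolution L u w (fun t => c * f t) x :=
      greenSolution_congr_ae hL (Lp.coeFn_smul c f) hx
    change greenSolution L u w (c • f : ScalarSpace L) x = c * greenSolution L u w f x
    rw [h1]
    simp only [greenSolution, mul_left_comm _ c, intervalIntegral.integral_const_mul]
    ring

/-- The continuous functions on `[0, L]` as elements of `L²(0, L)`. -/
def continuousToScalar (hL : 0 ≤ L) (f : BoundedContinuousFunction (Set.Icc (0 : ℝ) L) ℝ) :
    ScalarSpace L :=
  BoundedContinuousFunction.toLp 2 (volume.restrict (Set.Ioo (0 : ℝ) L)) ℝ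
    (f.compContinuous ⟨Set.projIcc 0 L hL, continuous_projIcc⟩)

lemma continuous_continuousToScalar (hL : 0 ≤ L) : Continuous (continuousToScalar hL) :=
  (ContinuousLinearMap.continuous _).comp
    (BoundedContinuousFunction.continuous_compContinuous _)

/-- The Green operator: the inverse of `κ - d²/dx²` under the boundary conditions. -/
def greenOperator (hL : 0 ≤ L) (h : IsGreenPair L γ κ u u' w w') :
    ScalarSpace L →ₗ[ℝ] ScalarSpace L where
  toFun f := continuousToScalar hL (greenToContinuous hL h f)
  map_add' f g := by
    rw [map_add]
    exact (BoundedContinuousFunction.toLp (E := ℝ) 2 (volume.restrict (Set.Ioo (0 : ℝ) L))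
      ℝ).map_add ((greenToContinuous hL h f).compContinuous _)
        ((greenToContinuous hL h g).compContinuous _)
  map_smul' c f := by
    rw [map_smul]
    exact (BoundedContinuousFunction.toLp (E := ℝ) 2 (volume.restrict (Set.Ioo (0 : ℝ) L))
      ℝ).map_smul c ((greenToContinuous hL h f).compContinuous _)

lemma coeFn_greenOperator (hL : 0 ≤ L) (h : IsGreenPair L γ κ u u' w w') (f : ScalarSpace L) :
    ∀ᵐ x ∂(volume.restrict (Set.Ioo 0 L)), greenOperator hL h f x = greenSolution L u w f x := by
  filter_upwards [BoundedContinuousFunction.coeFn_toLp 2 (volume.restrict (Set.Ioo (0 : ℝ) L)) ℝ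
    ((greenToContinuous hL h f).compContinuous ⟨Set.projIcc 0 L hL, continuous_projIcc⟩),
    self_mem_ae_restrict measurableSet_Ioo] with x hx hx'
  refine hx.trans ?_
  have hxI : x ∈ Set.Icc 0 L := ⟨hx'.1.le, hx'.2.le⟩
  change greenSolution L u w f (Set.projIcc 0 L hL x) = _
  rw [Set.projIcc_of_mem hL hxI]

/-- Green's identity makes the Green operator symmetric. -/
lemma isSymmetric_greenOperator (hL : 0 ≤ L) (hγ : ∀ i, γ i 0 ^ 2 + γ i 1 ^ 2 ≠ 0)
    (h : IsGreenPair L γ κ u u' w w') : (greenOperator hL h).IsSymmetric := by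
  intro f g
  have df := h.isDomainFunction hL (f.intervalIntegrable hL)
  have dg := h.isDomainFunction hL (g.intervalIntegrable hL)
  have key := df.integral_symm hL hγ dg
  have cf := df.deriv.continuousOn
  have cg := dg.deriv.continuousOn
  rw [← Set.uIcc_of_le hL] at cf cg
  have icc : IntervalIntegrable
      (fun x => κ * greenSolution L u w f x * greenSolution L u w g x) volume 0 L :=
    ((cf.const_mul κ).mul cg).intervalIntegrable
  have i1 : IntervalIntegrable (fun x => f x * greenSolution L u w g x) volume 0 L :=
    (f.intervalIntegrable hL).mul_continuousOn cg
  have i2 : IntervalIntegrable (fun x => greenSolution L u w f x * g x) volume 0 L :=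
    (g.intervalIntegrable hL).continuousOn_mul cf
  have e1 : ∫ x in (0 : ℝ)..L, (κ * greenSolution L u w f x - f x) * greenSolution L u w g x =
      (∫ x in (0 : ℝ)..L, κ * greenSolution L u w f x * greenSolution L u w g x) -
        ∫ x in (0 : ℝ)..L, f x * greenSolution L u w g x := by
    rw [← intervalIntegral.integral_sub icc i1]
    simp only [sub_mul]
  have e2 : ∫ x in (0 : ℝ)..L, greenSolution L u w f x * (κ * greenSolution L u w g x - g x) =
      (∫ x in (0 : ℝ)..L, κ * greenSolution L u w f x * greenSolution L u w g x) -
        ∫ x in (0 : ℝ)..L, greenSolution L u w f x * g x := by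
    rw [← intervalIntegral.integral_sub icc i2]
    congr 1; ext x; ring
  rw [e1, e2] at key
  rw [ScalarSpace.inner_eq hL, ScalarSpace.inner_eq hL, intervalIntegral_eq_integral_Ioo hL,
    intervalIntegral_eq_integral_Ioo hL]
  have a1 : ∫ x in Set.Ioo 0 L, greenOperator hL h f x * g x =
      ∫ x in (0 : ℝ)..L, greenSolution L u w f x * g x := by
    rw [intervalIntegral_eq_integral_Ioo hL]
    apply integral_congr_ae
    filter_upwards [coeFn_greenOperator hL h f] with x hx
    rw [hx]
  have a2 : ∫ x in Set.Ioo 0 L, f x * greenOperator hL h g x =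
      ∫ x in (0 : ℝ)..L, f x * greenSolution L u w g x := by
    rw [intervalIntegral_eq_integral_Ioo hL]
    apply integral_congr_ae
    filter_upwards [coeFn_greenOperator hL h g] with x hx
    rw [hx]
  rw [a1, a2]
  linarith

lemma ScalarSpace.integral_abs_le (hL : 0 ≤ L) {f : ScalarSpace L} (hf : ‖f‖ ≤ 1) :
    ∫ x in (0 : ℝ)..L, |f x| ≤ L + 1 := by
  have h1 : ∫ x in (0 : ℝ)..L, f x * f x ≤ 1 := by
    rw [← ScalarSpace.inner_eq hL, real_inner_self_eq_norm_sq]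
    nlinarith [norm_nonneg f]
  have i2 : IntervalIntegrable (fun x => f x * f x) volume 0 L := by
    rw [intervalIntegrable_iff_integrableOn_Ioo_of_le hL]
    simpa [sq, IntegrableOn] using (Lp.memLp f).integrable_sq
  calc ∫ x in (0 : ℝ)..L, |f x| ≤ ∫ x in (0 : ℝ)..L, (1 + f x * f x) := by
        refine intervalIntegral.integral_mono_on hL (f.intervalIntegrable hL).abs
          ((intervalIntegrable_const (c := (1 : ℝ))).add i2) fun x _ => ?_
        nlinarith [sq_nonneg (|f x| - 1), sq_abs (f x), abs_nonneg (f x)]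
    _ = L + ∫ x in (0 : ℝ)..L, f x * f x := by
        rw [intervalIntegral.integral_add (intervalIntegrable_const (c := (1 : ℝ))) i2]; simp
    _ ≤ L + 1 := by linarith

/-- By the variation of constants formula the image of the unit ball is bounded and uniformly
Lipschitz, so compactness is the Arzelà–Ascoli theorem. -/
lemma isCompactOperator_greenOperator (hL : 0 ≤ L) (h : IsGreenPair L γ κ u u' w w') :
    IsCompactOperator (greenOperator hL h) := by
  obtain ⟨M, hM0, hMu, hMu', hMw, hMw'⟩ : ∃ M : ℝ, 0 ≤ M ∧ (∀ y ∈ Set.Icc 0 L, |u y| ≤ M) ∧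
      (∀ y ∈ Set.Icc 0 L, |u' y| ≤ M) ∧ (∀ y ∈ Set.Icc 0 L, |w y| ≤ M) ∧
      (∀ y ∈ Set.Icc 0 L, |w' y| ≤ M) := by
    have hb : ∀ v : ℝ → ℝ, Continuous v → ∃ M, ∀ y ∈ Set.Icc 0 L, |v y| ≤ M := fun v hv =>
      isCompact_Icc.exists_bound_of_continuousOn hv.continuousOn
    obtain ⟨M₁, h1⟩ := hb u h.continuous_u
    obtain ⟨M₂, h2⟩ := hb u' h.continuous_u'
    obtain ⟨M₃, h3⟩ := hb w h.continuous_w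
    obtain ⟨M₄, h4⟩ := hb w' h.continuous_w'
    refine ⟨max (max |M₁| |M₂|) (max |M₃| |M₄|), by positivity, fun y hy => ?_, fun y hy => ?_,
      fun y hy => ?_, fun y hy => ?_⟩
    · exact (h1 y hy).trans ((le_abs_self _).trans (by simp))
    · exact (h2 y hy).trans ((le_abs_self _).trans (by simp))
    · exact (h3 y hy).trans ((le_abs_self _).trans (by simp))
    · exact (h4 y hy).trans ((le_abs_self _).trans (by simp))
  set I := L + 1 with hI
  set C := M * (M * I) + M * (M * I + M * I) with hC
  have bound : ∀ (f : ScalarSpace L), ‖f‖ ≤ 1 → ∀ a b : ℝ → ℝ, (∀ y ∈ Set.Icc 0 L, |a y| ≤ M) →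
      (∀ y ∈ Set.Icc 0 L, |b y| ≤ M) → ∀ x ∈ Set.Icc 0 L,
      |b x * (∫ y in (0 : ℝ)..x, u y * f y) +
        a x * ((∫ y in (0 : ℝ)..L, w y * f y) - ∫ y in (0 : ℝ)..x, w y * f y)| ≤ C := by
    intro f hf a b ha hb x hx
    have hi := ScalarSpace.integral_abs_le hL hf
    have j1 := abs_integral_mul_le hx hMu (f.intervalIntegrable hL) hi
    have j2 := abs_integral_mul_le hx hMw (f.intervalIntegrable hL) hi
    have j3 := abs_integral_mul_le (x := L) ⟨hL, le_rfl⟩ hMw (f.intervalIntegrable hL) hi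
    refine (abs_add_le _ _).trans (add_le_add ?_ ?_)
    · rw [abs_mul]
      exact mul_le_mul (hb x hx) j1 (abs_nonneg _) hM0
    · rw [abs_mul]
      exact mul_le_mul (ha x hx) ((abs_sub _ _).trans (add_le_add j3 j2)) (abs_nonneg _) hM0
  have hC0 : 0 ≤ C := by positivity
  rw [isCompactOperator_iff_exists_mem_nhds_image_subset_compact]
  set A := greenToContinuous hL h '' Metric.closedBall 0 1 with hA
  have hAcomp : IsCompact (closure A) := by
    refine BoundedContinuousFunction.arzela_ascoli (Set.Icc (-C) C) isCompact_Icc A ?_ ?_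
    · rintro _ x ⟨f, hf, rfl⟩
      rw [mem_closedBall_zero_iff] at hf
      exact abs_le.1 (bound f hf u w hMu hMw x x.2)
    · refine (LipschitzWith.uniformEquicontinuous (K := ⟨C, hC0⟩) _ ?_).equicontinuous
      rintro ⟨_, f, hf, rfl⟩
      rw [mem_closedBall_zero_iff] at hf
      refine LipschitzWith.of_dist_le_mul fun x y => ?_
      have hd := (h.isDomainFunction hL (f.intervalIntegrable hL))
      have := Convex.norm_image_sub_le_of_norm_hasDerivWithin_le
        (fun t ht => hd.deriv.hasDerivWithinAt hd.deriv₂.continuousOn ht)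
        (fun t ht => bound f hf u' w' hMu' hMw' t ht) (convex_Icc 0 L) y.2 x.2
      rw [dist_eq_norm, Subtype.dist_eq, dist_eq_norm]
      exact this
  refine ⟨Metric.closedBall 0 1, Metric.closedBall_mem_nhds 0 one_pos,
    continuousToScalar hL '' closure A, hAcomp.image (continuous_continuousToScalar hL), ?_⟩
  rintro _ ⟨f, hf, rfl⟩
  exact ⟨_, subset_closure ⟨f, hf, rfl⟩, rfl⟩

end Green

/-! ### Completeness of the eigenfunctions -/

section Completeness

variable {L : ℝ} {γ : Matrix (Fin 2) (Fin 2) ℝ}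

lemma IsPrimitive.ae_eq_zero {F f : ℝ → ℝ} (hF : IsPrimitive L F f)
    (h0 : ∀ x ∈ Set.Icc 0 L, F x = 0) : ∀ᵐ x ∂(volume.restrict (Set.Ioo 0 L)), f x = 0 := by
  rw [ae_restrict_iff' measurableSet_Ioo]
  filter_upwards [hF.intervalIntegrable.ae_hasDerivAt_integral] with x hx hx'
  have hL : 0 ≤ L := (hx'.1.trans hx'.2).le
  have hxI : x ∈ Set.Icc 0 L := ⟨hx'.1.le, hx'.2.le⟩
  have h1 := hx (by rwa [Set.uIcc_of_le hL]) 0 (by simp)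
  refine h1.unique ((hasDerivAt_const x (0 : ℝ)).congr_of_eventuallyEq ?_)
  filter_upwards [Icc_mem_nhds hx'.1 hx'.2] with t ht
  have := hF.eq_add_integral t ht
  rw [h0 t ht, h0 0 ⟨le_rfl, hL⟩] at this
  linarith

lemma eqOn_Icc_of_ae_eq (hL : 0 < L) {f g : ℝ → ℝ} (hf : ContinuousOn f (Set.Icc 0 L))
    (hg : ContinuousOn g (Set.Icc 0 L))
    (h : ∀ᵐ x ∂(volume.restrict (Set.Ioo 0 L)), f x = g x) : Set.EqOn f g (Set.Icc 0 L) := by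
  refine Measure.eqOn_Icc_of_ae_eq volume hL.ne ?_ hf hg
  rwa [Measure.restrict_congr_set Ioo_ae_eq_Icc] at h

/-- An element of the kernel of the Green operator vanishes: it is recovered by applying
`κ - d²/dx²` to its image. -/
lemma eq_zero_of_greenOperator_eq_zero (hL : 0 < L) {κ : ℝ} {u u' w w' : ℝ → ℝ}
    (h : IsGreenPair L γ κ u u' w w') {g : ScalarSpace L} (hg : greenOperator hL.le h g = 0) :
    g = 0 := by
  have hd := h.isDomainFunction hL.le (g.intervalIntegrable hL.le)
  have hv : ∀ x ∈ Set.Icc 0 L, greenSolution L u w g x = 0 := by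
    refine eqOn_Icc_of_ae_eq hL hd.deriv.continuousOn (g := fun _ => 0) continuousOn_const ?_
    have h0 := Lp.coeFn_zero ℝ 2 (volume.restrict (Set.Ioo (0 : ℝ) L))
    have h1 := coeFn_greenOperator hL.le h g
    rw [hg] at h1
    filter_upwards [h0, h1] with x hx0 hx1
    rw [← hx1, hx0]; rfl
  have hv₁ : ∀ x ∈ Set.Icc 0 L, w' x * (∫ y in (0 : ℝ)..x, u y * g y) +
        u' x * ((∫ y in (0 : ℝ)..L, w y * g y) - ∫ y in (0 : ℝ)..x, w y * g y) = 0 := by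
    intro x hx
    exact (uniqueDiffOn_Icc hL x hx).eq_deriv _
      (hd.deriv.hasDerivWithinAt hd.deriv₂.continuousOn hx)
      ((hasDerivWithinAt_const x (Set.Icc 0 L) (0 : ℝ)).congr hv (hv x hx))
  have h2 := hd.deriv₂.ae_eq_zero hv₁
  refine Lp.ext ?_
  filter_upwards [h2, Lp.coeFn_zero ℝ 2 (volume.restrict (Set.Ioo (0 : ℝ) L)),
    self_mem_ae_restrict measurableSet_Ioo] with x hx h0 hxI
  rw [h0]
  rw [hv x ⟨hxI.1.le, hxI.2.le⟩] at hx
  change g x = 0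
  linarith

/-- Eigenvectors of the Green operator are Sturm–Liouville eigenfunctions: if `G g = μ g` with
`μ ≠ 0`, then `μ g` has the second derivative `κ μ g - g`. -/
lemma exists_isEigenfunction_of_greenOperator (hL : 0 < L) {κ : ℝ} {u u' w w' : ℝ → ℝ}
    (h : IsGreenPair L γ κ u u' w w') {μ : ℝ} (hμ : μ ≠ 0) {g : ScalarSpace L} (hg0 : g ≠ 0)
    (hg : greenOperator hL.le h g = μ • g) :
    ∃ ψ : ℝ → ℝ, IsEigenfunction L γ (1 / μ - κ) ψ ∧
      ∀ᵐ x ∂(volume.restrict (Set.Ioo 0 L)), g x = 1 / μ * ψ x := by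
  have hd := h.isDomainFunction hL.le (g.intervalIntegrable hL.le)
  have hae : ∀ᵐ x ∂(volume.restrict (Set.Ioo 0 L)), g x = 1 / μ * greenSolution L u w g x := by
    have h1 := coeFn_greenOperator hL.le h g
    rw [hg] at h1
    filter_upwards [h1, Lp.coeFn_smul μ g] with x hx hx'
    rw [← hx, hx', Pi.smul_apply, smul_eq_mul]
    field_simp
  refine ⟨greenSolution L u w g, IsDomainFunction.isEigenfunction
    ⟨hd.deriv, hd.deriv₂.congr_ae hL.le ?_, hd.left, hd.right⟩ ?_, hae⟩
  · filter_upwards [hae] with x hx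
    rw [hx]; ring
  · by_contra! hz
    apply hg0
    refine Lp.ext ?_
    filter_upwards [hae, Lp.coeFn_zero ℝ 2 (volume.restrict (Set.Ioo (0 : ℝ) L)),
      self_mem_ae_restrict measurableSet_Ioo] with x hx h0 hxI
    rw [h0, hx, hz x ⟨hxI.1.le, hxI.2.le⟩]
    simp

variable {lam : ℕ → ℝ} {φ : ℕ → ℝ → ℝ}

lemma memLp_of_continuousOn {f : ℝ → ℝ} (hf : ContinuousOn f (Set.Icc 0 L)) :
    MemLp f 2 (volume.restrict (Set.Ioo 0 L)) := by
  obtain ⟨C, hC⟩ := isCompact_Icc.exists_bound_of_continuousOn hf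
  refine MemLp.of_bound
    ((hf.mono Set.Ioo_subset_Icc_self).aestronglyMeasurable measurableSet_Ioo) C ?_
  filter_upwards [self_mem_ae_restrict measurableSet_Ioo] with x hx
  exact hC x ⟨hx.1.le, hx.2.le⟩

lemma IsEigensystem.integral_mul_eq_zero (hL : 0 ≤ L) (hγ : ∀ i, γ i 0 ^ 2 + γ i 1 ^ 2 ≠ 0)
    (hφ : IsEigensystem L γ lam φ) {n k : ℕ} (hnk : n ≠ k) :
    ∫ x in (0 : ℝ)..L, φ n x * φ k x = 0 := by
  obtain ⟨φ', hn⟩ := (hφ.eigenfunction n).exists_isDomainFunction hL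
  obtain ⟨ψ', hk⟩ := (hφ.eigenfunction k).exists_isDomainFunction hL
  have key := hn.integral_symm hL hγ hk
  have e1 : ∀ x, -(lam n * φ n x) * φ k x = -lam n * (φ n x * φ k x) := fun x => by ring
  have e2 : ∀ x, φ n x * -(lam k * φ k x) = -lam k * (φ n x * φ k x) := fun x => by ring
  simp only [e1, e2, intervalIntegral.integral_const_mul] at key
  have hne : lam n - lam k ≠ 0 := sub_ne_zero.2 (hφ.strictMono.injective.ne hnk)
  refine (mul_eq_zero.1 (?_ : (lam n - lam k) * _ = 0)).resolve_left hne
  linear_combination -key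

/-- Below the smallest eigenvalue the operator is invertible, its inverse is the compact symmetric
Green operator, and the spectral theorem for the latter gives completeness. -/
theorem IsEigensystem.exists_hilbertBasis (hL : 0 < L) (hγ : ∀ i, γ i 0 ^ 2 + γ i 1 ^ 2 ≠ 0)
    (hφ : IsEigensystem L γ lam φ) :
    ∃ e : HilbertBasis ℕ ℝ (ScalarSpace L),
      ∀ n, ∀ᵐ x ∂(volume.restrict (Set.Ioo 0 L)), e n x = φ n x := by
  let v : ℕ → ScalarSpace L := fun n =>
    (memLp_of_continuousOn (hφ.eigenfunction n).continuousOn).toLp (φ n)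
  have hv : ∀ n, ∀ᵐ x ∂(volume.restrict (Set.Ioo 0 L)), v n x = φ n x := fun n =>
    MemLp.coeFn_toLp _
  have hinner : ∀ n k, inner ℝ (v n) (v k) = ∫ x in (0 : ℝ)..L, φ n x * φ k x := by
    intro n k
    rw [ScalarSpace.inner_eq hL.le, intervalIntegral_eq_integral_Ioo hL.le,
      intervalIntegral_eq_integral_Ioo hL.le]
    apply integral_congr_ae
    filter_upwards [hv n, hv k] with x h1 h2
    rw [h1, h2]
  have hon : Orthonormal ℝ v := by
    rw [orthonormal_iff_ite]
    intro n k
    rw [hinner]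
    split_ifs with hnk
    · subst hnk
      simpa [sq] using hφ.normalized n
    · exact hφ.integral_mul_eq_zero hL.le hγ hnk
  set k := |lam 0| + 1 with hk
  have hk0 : k ≠ 0 := by positivity
  have hklt : -k ^ 2 < lam 0 := by nlinarith [abs_nonneg (lam 0), neg_abs_le (lam 0)]
  have hne : ¬ ∃ ψ, IsEigenfunction L γ (-k ^ 2) ψ := by
    rintro ⟨ψ, hψ⟩
    obtain ⟨n, hn⟩ := hφ.exhaustive _ _ hψ
    have := hφ.strictMono.monotone (Nat.zero_le n)
    linarith
  obtain ⟨u, u', w, w', hg⟩ := exists_isGreenPair hL hγ hk0 hne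
  have hcomp := isCompactOperator_greenOperator hL.le hg
  let T : ScalarSpace L →L[ℝ] ScalarSpace L := ContinuousLinearMap.mkOfIsCompactOperator hcomp
  have hspec := ContinuousLinearMap.orthogonalComplement_iSup_eigenspaces_eq_bot (T := T) hcomp
    (isSymmetric_greenOperator hL.le hγ hg)
  have hperp : (Submodule.span ℝ (Set.range v))ᗮ = ⊥ := by
    rw [eq_bot_iff, ← hspec]
    intro f hf
    rw [← Submodule.iInf_orthogonal, Submodule.mem_iInf]
    intro μ
    rw [Submodule.mem_orthogonal]
    intro g hgμ
    have hTg : greenOperator hL.le hg g = μ • g := Module.End.mem_eigenspace_iff.1 hgμ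
    by_cases hg0 : g = 0
    · rw [hg0, inner_zero_left]
    by_cases hμ : μ = 0
    · rw [hμ, zero_smul] at hTg
      exact absurd (eq_zero_of_greenOperator_eq_zero hL hg hTg) hg0
    obtain ⟨ψ, hψ, hae⟩ := exists_isEigenfunction_of_greenOperator hL hg hμ hg0 hTg
    obtain ⟨n, hn⟩ := hφ.exhaustive _ _ hψ
    obtain ⟨c, hc⟩ := (hn ▸ hφ.eigenfunction n).exists_eq_const_mul hγ hψ
    have hgv : g = (1 / μ * c) • v n := by
      refine Lp.ext ?_
      filter_upwards [hae, Lp.coeFn_smul (1 / μ * c) (v n), hv n,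
        self_mem_ae_restrict measurableSet_Ioo] with x h1 h2 h3 hx
      rw [h1, h2, Pi.smul_apply, h3, hc x ⟨hx.1.le, hx.2.le⟩, smul_eq_mul]
      ring
    rw [hgv, inner_smul_left,
      (Submodule.mem_orthogonal _ _).1 hf _ (Submodule.subset_span ⟨n, rfl⟩), mul_zero]
  exact ⟨HilbertBasis.mkOfOrthogonalEqBot hon hperp, fun n => by
    rw [HilbertBasis.coe_mkOfOrthogonalEqBot]; exact hv n⟩

end Completeness

open Matrix

/-! ### The backstepping transformation of a single mode -/

section Transformation

variable {m : ℕ} [NeZero m] {d : Fin m → ℝ} {Q : Matrix (Fin m) (Fin m) ℝ}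
  {Tbar : ℕ → Matrix (Fin m) (Fin m) ℝ}

lemma colB_mul_transpose_mul (M : Matrix (Fin m) (Fin m) ℝ) (i k : Fin m) :
    (colB m * (colB m).transpose * M) i k = if i = 0 then M 0 k else 0 := by
  rw [Matrix.mul_assoc, Matrix.mul_apply]
  simp [colB, Matrix.mul_apply]

lemma exists_sigma_eq (d : Fin m → ℝ) :
    ∃ p : Fin m, (p : ℕ) + 1 = sigma d ∧ ∀ j : Fin m, p ≤ j → d p = d j :=
  Nat.sInf_mem (s := {i : ℕ | ∃ p : Fin m, (p : ℕ) + 1 = i ∧ ∀ j : Fin m, p ≤ j → d p = d j})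
    ⟨((⊤ : Fin m) : ℕ) + 1, ⊤, rfl, fun j hj => by rw [top_le_iff.1 hj]⟩

/-- The recursion terminates: the last term `T̄_σ̄ (D - d_m I)` has no entries below the first
row. -/
lemma SolvesSylvester.last_eq_zero (hT : SolvesSylvester d Q Tbar) {j : Fin m} (hj : j ≠ 0)
    (k : Fin m) : Tbar (sigmaBar d) j k * (d k - d ⊤) = 0 := by
  obtain ⟨p, hp, hpd⟩ := exists_sigma_eq d
  by_cases hk : p ≤ k
  · rw [← hpd k hk, ← hpd ⊤ le_top, sub_self, mul_zero]
  · have hkp : (k : ℕ) < p := by simpa using hk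
    have hj' : 0 < (j : ℕ) := Nat.pos_of_ne_zero fun h => hj (Fin.ext (by simpa using h))
    have hpm := p.isLt
    have hjm := j.isLt
    have : Tbar (sigmaBar d) j k = 0 := by
      rcases Nat.eq_zero_or_pos (sigmaBar d) with h0 | h0
      · have hjk : j ≠ k := by
          rintro rfl
          unfold sigmaBar at h0
          omega
        rw [h0, hT.zero, Matrix.one_apply_ne hjk]
      · refine hT.shape _ (Finset.mem_Icc.2 ⟨h0, le_rfl⟩) j k ?_
        unfold sigmaBar at h0 ⊢
        omega
    rw [this, zero_mul]

lemma SolvesSylvester.apply_eq_zero_of_le (hT : SolvesSylvester d Q Tbar) {i : ℕ}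
    (hi : i ∈ Finset.Icc 1 (sigmaBar d)) {j k : Fin m} (hkj : k ≤ j) : Tbar i j k = 0 := by
  refine hT.shape i hi j k ?_
  have h1 := (Finset.mem_Icc.1 hi).1
  have h2 : (k : ℕ) ≤ j := hkj
  omega

lemma SolvesSylvester.transf_apply_of_le (hT : SolvesSylvester d Q Tbar) (μ : ℝ) {j k : Fin m}
    (hkj : k ≤ j) : transf d Tbar μ j k = (1 : Matrix (Fin m) (Fin m) ℝ) j k := by
  rw [transf, Matrix.add_apply, Matrix.sum_apply, Finset.sum_eq_zero, add_zero]
  intro i hi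
  rw [Matrix.smul_apply, hT.apply_eq_zero_of_le hi hkj, smul_zero]

lemma SolvesSylvester.det_transf (hT : SolvesSylvester d Q Tbar) (μ : ℝ) :
    (transf d Tbar μ).det = 1 := by
  rw [Matrix.det_of_isUpperTriangular]
  · exact Finset.prod_eq_one fun i _ => by rw [hT.transf_apply_of_le μ le_rfl, Matrix.one_apply_eq]
  · intro j k hkj
    have hkj' : k < j := hkj
    exact (hT.transf_apply_of_le μ hkj'.le).trans (Matrix.one_apply_ne hkj'.ne')

lemma SolvesSylvester.transf_mul_colB (hT : SolvesSylvester d Q Tbar) (μ : ℝ) :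
    transf d Tbar μ * colB m = colB m := by
  ext i j
  rw [Matrix.mul_apply]
  have : ∀ k, transf d Tbar μ i k * colB m k j = if k = 0 then transf d Tbar μ i 0 else 0 := by
    intro k
    by_cases hk : k = 0 <;> simp [colB, hk]
  simp only [this, Finset.sum_ite_eq', Finset.mem_univ, if_true]
  rw [hT.transf_apply_of_le μ (Fin.zero_le i)]
  simp [colB, Matrix.one_apply]

/-- Multiplying the `i`-th Sylvester equation by `μⁱ` and summing, the sums telescope. -/
lemma SolvesSylvester.telescope (hT : SolvesSylvester d Q Tbar) (μ : ℝ) :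
    (1 - colB m * (colB m).transpose) *
      (Q * transf d Tbar μ - transf d Tbar μ * Q
        + μ • (transf d Tbar μ * (Matrix.diagonal d - d ⊤ • 1))) = 0 := by
  set E := 1 - colB m * (colB m).transpose with hE
  set R := Matrix.diagonal d - d ⊤ • (1 : Matrix (Fin m) (Fin m) ℝ) with hR
  have partialSum : ∀ s ≤ sigmaBar d,
      E * (Q * (1 + ∑ i ∈ Finset.Icc 1 s, μ ^ i • Tbar i)
        - (1 + ∑ i ∈ Finset.Icc 1 s, μ ^ i • Tbar i) * Q
        + μ • ((1 + ∑ i ∈ Finset.Icc 1 s, μ ^ i • Tbar i) * R)) =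
      μ ^ (s + 1) • (E * (Tbar s * R)) := by
    intro s
    induction s with
    | zero => intro _; simp [hT.zero]
    | succ s ih =>
      intro hs
      have ih' := ih (by omega)
      have hsyl := hT.sylvester (s + 1) (Finset.mem_Icc.2 ⟨by omega, hs⟩)
      rw [Nat.add_sub_cancel, ← hE, ← hR] at hsyl
      rw [Finset.sum_Icc_succ_top (by omega)]
      set S := 1 + ∑ i ∈ Finset.Icc 1 s, μ ^ i • Tbar i with hS
      rw [← add_assoc, ← hS]
      have e1 : E * (Q * (S + μ ^ (s + 1) • Tbar (s + 1)) - (S + μ ^ (s + 1) • Tbar (s + 1)) * Q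
          + μ • ((S + μ ^ (s + 1) • Tbar (s + 1)) * R)) =
          E * (Q * S - S * Q + μ • (S * R)) +
          μ ^ (s + 1) • (E * (Q * Tbar (s + 1) - Tbar (s + 1) * Q + Tbar s * R)) -
          μ ^ (s + 1) • (E * (Tbar s * R)) + μ ^ (s + 1 + 1) • (E * (Tbar (s + 1) * R)) := by
        simp only [Matrix.mul_add, Matrix.add_mul, Matrix.mul_sub, Matrix.mul_smul,
          Matrix.smul_mul, smul_add, smul_sub, smul_smul, pow_succ]
        rw [show μ * (μ ^ s * μ) = μ ^ s * μ * μ by ring]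
        abel
      rw [e1, ih', hsyl, smul_zero, add_zero, sub_self, zero_add]
  have := partialSum _ le_rfl
  rw [transf, this]
  convert smul_zero _
  ext j k
  rw [hE, Matrix.sub_mul, Matrix.sub_apply, colB_mul_transpose_mul, Matrix.one_mul]
  have hentry : ∀ j, (Tbar (sigmaBar d) * R) j k = Tbar (sigmaBar d) j k * (d k - d ⊤) := by
    intro j
    rw [hR, Matrix.mul_sub, Matrix.sub_apply, Matrix.mul_diagonal, Matrix.mul_smul,
      Matrix.mul_one, Matrix.smul_apply, smul_eq_mul]
    ring
  by_cases hj : j = 0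
  · simp [hj]
  · rw [if_neg hj, sub_zero, hentry, hT.last_eq_zero hj]; rfl

/-- The transformation `T` conjugates the closed-loop matrix of a mode into
`Q - μ d_m I + B K_Q`. -/
theorem SolvesSylvester.transf_mul_closedLoop (hT : SolvesSylvester d Q Tbar)
    (KQ : Matrix (Fin 1) (Fin m) ℝ) (μ : ℝ) :
    transf d Tbar μ * (Q - μ • Matrix.diagonal d + colB m * modeGain d Q Tbar KQ μ) =
      (Q - (μ * d ⊤) • 1 + colB m * KQ) * transf d Tbar μ := by
  have htel := hT.telescope μ
  have hTB := hT.transf_mul_colB μ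
  rw [modeGain]
  set T := transf d Tbar μ
  set Y := (Q - (μ * d ⊤) • 1) * T + T * (μ • Matrix.diagonal d - Q) with hY
  have hY' : Y = Q * T - T * Q + μ • (T * (Matrix.diagonal d - d ⊤ • 1)) := by
    rw [hY]
    simp only [Matrix.mul_sub, Matrix.sub_mul, Matrix.mul_smul, Matrix.smul_mul, smul_sub,
      smul_smul, Matrix.mul_one, Matrix.one_mul]
    abel
  rw [← hY', Matrix.sub_mul, Matrix.one_mul, sub_eq_zero] at htel
  have e : T * (Q - μ • Matrix.diagonal d + colB m * ((colB m).transpose * Y + KQ * T)) =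
      T * (Q - μ • Matrix.diagonal d) + colB m * (colB m).transpose * Y + colB m * KQ * T := by
    rw [Matrix.mul_add, ← Matrix.mul_assoc T, hTB, Matrix.mul_add, ← Matrix.mul_assoc,
      ← Matrix.mul_assoc]
    abel
  rw [e, ← htel, hY]
  simp only [Matrix.mul_sub, Matrix.sub_mul, Matrix.add_mul]
  abel

end Transformation

/-! ### Quadratic forms and Lyapunov functions -/

section Quadratic

variable {ι : Type*} [Fintype ι] {n : ℕ}

lemma dotProduct_self_pos {x : ι → ℝ} (hx : x ≠ 0) : 0 < x ⬝ᵥ x :=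
  lt_of_le_of_ne (Finset.sum_nonneg fun i _ => mul_self_nonneg (x i))
    fun h => hx (dotProduct_self_eq_zero.1 h.symm)

lemma isCompact_unitSphere_dotProduct : IsCompact {x : ι → ℝ | x ⬝ᵥ x = 1} := by
  refine (isCompact_closedBall (0 : ι → ℝ) 1).of_isClosed_subset
    (isClosed_eq (by fun_prop) continuous_const) fun x hx => ?_
  rw [mem_closedBall_zero_iff, pi_norm_le_iff_of_nonneg zero_le_one]
  intro i
  have h1 : x i * x i ≤ x ⬝ᵥ x :=
    Finset.single_le_sum (f := fun i => x i * x i) (fun j _ => mul_self_nonneg _)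
      (Finset.mem_univ i)
  rw [hx] at h1
  exact abs_le_one_iff_mul_self_le_one.2 h1

lemma exists_unit_of_ne_zero {x : ι → ℝ} (hx : x ≠ 0) :
    ∃ (c : ℝ) (y : ι → ℝ), y ⬝ᵥ y = 1 ∧ x = c • y ∧ c ^ 2 = x ⬝ᵥ x := by
  have hpos := dotProduct_self_pos hx
  have hs : Real.sqrt (x ⬝ᵥ x) ≠ 0 := (Real.sqrt_pos.2 hpos).ne'
  have hsq : Real.sqrt (x ⬝ᵥ x) ^ 2 = x ⬝ᵥ x := Real.sq_sqrt hpos.le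
  refine ⟨Real.sqrt (x ⬝ᵥ x), (Real.sqrt (x ⬝ᵥ x))⁻¹ • x, ?_, by rw [smul_inv_smul₀ hs], hsq⟩
  rw [smul_dotProduct, dotProduct_smul, smul_eq_mul, smul_eq_mul, ← mul_assoc, ← sq, inv_pow,
    hsq, inv_mul_cancel₀ hpos.ne']

/-- A continuous function, homogeneous of degree two, is bounded by a multiple of `|x|²`. -/
lemma exists_le_mul_dotProduct {q : (ι → ℝ) → ℝ} (hq : Continuous q)
    (hom : ∀ (c : ℝ) x, q (c • x) = c ^ 2 * q x) : ∃ C : ℝ, 0 < C ∧ ∀ x, q x ≤ C * (x ⬝ᵥ x) := by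
  obtain ⟨C, hC⟩ := isCompact_unitSphere_dotProduct.exists_bound_of_continuousOn hq.continuousOn
  refine ⟨|C| + 1, by positivity, fun x => ?_⟩
  by_cases hx : x = 0
  · have h0 : q 0 = 0 := by simpa using hom 0 0
    simp [hx, h0]
  · obtain ⟨c, y, hy, rfl, hc⟩ := exists_unit_of_ne_zero hx
    rw [← hc, hom, mul_comm]
    refine mul_le_mul_of_nonneg_right ?_ (sq_nonneg c)
    have := (le_abs_self _).trans (hC y hy)
    linarith [le_abs_self C]

/-- A continuous function, homogeneous of degree two and positive away from zero, is coercive. -/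
lemma exists_mul_dotProduct_le {q : (ι → ℝ) → ℝ} (hq : Continuous q)
    (hom : ∀ (c : ℝ) x, q (c • x) = c ^ 2 * q x) (hpos : ∀ x, x ≠ 0 → 0 < q x) :
    ∃ c : ℝ, 0 < c ∧ ∀ x, c * (x ⬝ᵥ x) ≤ q x := by
  have hbound : ∃ c : ℝ, 0 < c ∧ ∀ y : ι → ℝ, y ⬝ᵥ y = 1 → c ≤ q y := by
    rcases Set.eq_empty_or_nonempty {x : ι → ℝ | x ⬝ᵥ x = 1} with he | hne
    · exact ⟨1, one_pos, fun y hy => ((Set.ext_iff.1 he y).1 hy).elim⟩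
    · obtain ⟨y₀, hy₀, hmin⟩ :=
        isCompact_unitSphere_dotProduct.exists_isMinOn hne hq.continuousOn
      refine ⟨q y₀, hpos y₀ ?_, fun y hy => hmin hy⟩
      rintro rfl
      simp at hy₀
  obtain ⟨c, hc, hcq⟩ := hbound
  refine ⟨c, hc, fun x => ?_⟩
  by_cases hx : x = 0
  · have h0 : q 0 = 0 := by simpa using hom 0 0
    simp [hx, h0]
  · obtain ⟨a, y, hy, rfl, ha⟩ := exists_unit_of_ne_zero hx
    rw [← ha, hom, mul_comm]
    exact mul_le_mul_of_nonneg_left (hcq y hy) (sq_nonneg a)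

lemma quadForm_smul (M : Matrix ι ι ℝ) (c : ℝ) (x : ι → ℝ) :
    (c • x) ⬝ᵥ (M *ᵥ (c • x)) = c ^ 2 * (x ⬝ᵥ (M *ᵥ x)) := by
  rw [mulVec_smul, smul_dotProduct, dotProduct_smul, smul_eq_mul, smul_eq_mul]
  ring

lemma continuous_quadForm (M : Matrix ι ι ℝ) :
    Continuous fun x : ι → ℝ => x ⬝ᵥ (M *ᵥ x) := by
  fun_prop

lemma posDef_quadForm_pos {M : Matrix ι ι ℝ} (hM : M.PosDef) {x : ι → ℝ}
    (hx : x ≠ 0) : 0 < x ⬝ᵥ (M *ᵥ x) := by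
  simpa using hM.dotProduct_mulVec_pos hx

lemma quadForm_symPart (M : Matrix (Fin n) (Fin n) ℝ) (x : Fin n → ℝ) :
    x ⬝ᵥ (symPart M *ᵥ x) = x ⬝ᵥ (M *ᵥ x) := by
  have : x ⬝ᵥ (M.transpose *ᵥ x) = x ⬝ᵥ (M *ᵥ x) := by
    rw [mulVec_transpose, dotProduct_comm, ← dotProduct_mulVec]
  rw [symPart, smul_mulVec, add_mulVec, dotProduct_smul, dotProduct_add, this, smul_eq_mul]
  ring

/-- A differential inequality `f' ≤ -c f` gives exponential decay. -/
lemma le_exp_mul_of_deriv_le {f f' : ℝ → ℝ} {c : ℝ} (hf : ContinuousOn f (Set.Ici 0))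
    (hd : ∀ t, 0 < t → HasDerivAt f (f' t) t) (hle : ∀ t, 0 < t → f' t ≤ -c * f t) {t : ℝ}
    (ht : 0 ≤ t) : f t ≤ Real.exp (-(c * t)) * f 0 := by
  have he : ∀ t, HasDerivAt (fun t => Real.exp (c * t)) (c * Real.exp (c * t)) t := fun t => by
    have := ((hasDerivAt_id t).const_mul c).exp
    simpa [mul_comm] using this
  have hanti : AntitoneOn (fun t => Real.exp (c * t) * f t) (Set.Ici 0) := by
    have hder : ∀ t ∈ interior (Set.Ici (0 : ℝ)), HasDerivAt (fun t => Real.exp (c * t) * f t)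
        (c * Real.exp (c * t) * f t + Real.exp (c * t) * f' t) t := by
      intro t ht
      rw [interior_Ici] at ht
      exact (he t).mul (hd t ht)
    refine antitoneOn_of_deriv_nonpos (convex_Ici 0) ?_ ?_ ?_
    · exact (Continuous.continuousOn (by fun_prop)).mul hf
    · exact fun t ht => (hder t ht).differentiableAt.differentiableWithinAt
    · intro t ht
      rw [(hder t ht).deriv]
      rw [interior_Ici] at ht
      nlinarith [hle t ht, Real.exp_pos (c * t)]
  have := hanti (Set.mem_Ici.2 le_rfl) (Set.mem_Ici.2 ht) ht
  simp only [mul_zero, Real.exp_zero, one_mul] at this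
  rw [Real.exp_neg, inv_mul_eq_div, le_div_iff₀ (Real.exp_pos _), mul_comm]
  exact this

lemma hasDerivAt_dotProduct {a b : ℝ → ι → ℝ} {a' b' : ι → ℝ} {t : ℝ}
    (ha : HasDerivAt a a' t) (hb : HasDerivAt b b' t) :
    HasDerivAt (fun s => a s ⬝ᵥ b s) (a' ⬝ᵥ b t + a t ⬝ᵥ b') t := by
  simp only [dotProduct, ← Finset.sum_add_distrib]
  exact HasDerivAt.fun_sum fun i _ => (hasDerivAt_pi.1 ha i).mul (hasDerivAt_pi.1 hb i)

lemma hasDerivAt_mulVec (M : Matrix (Fin n) (Fin n) ℝ) {a : ℝ → Fin n → ℝ} {a' : Fin n → ℝ}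
    {t : ℝ} (ha : HasDerivAt a a' t) : HasDerivAt (fun s => M *ᵥ a s) (M *ᵥ a') t :=
  (M.mulVecLin.toContinuousLinearMap).hasFDerivAt.comp_hasDerivAt t ha

/-- Lyapunov's direct method with the quadratic Lyapunov function `x ↦ xᵀ S x`. -/
lemma exists_decay_of_lyapunov {S A : Matrix (Fin n) (Fin n) ℝ} {δ : ℝ} (hS : S.PosDef)
    (hA : ∀ x, x ⬝ᵥ ((S * A) *ᵥ x) ≤ -δ * (x ⬝ᵥ (S *ᵥ x))) :
    ∃ C : ℝ, 0 < C ∧ ∀ a : ℝ → Fin n → ℝ, ContinuousOn a (Set.Ici 0) →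
      (∀ t, 0 < t → HasDerivAt a (A *ᵥ a t) t) →
      ∀ t, 0 ≤ t → a t ⬝ᵥ a t ≤ C * Real.exp (-(2 * δ * t)) * (a 0 ⬝ᵥ a 0) := by
  obtain ⟨c, hc, hcS⟩ := exists_mul_dotProduct_le (continuous_quadForm S) (quadForm_smul S)
    fun x hx => posDef_quadForm_pos hS hx
  obtain ⟨C, hC, hCS⟩ := exists_le_mul_dotProduct (continuous_quadForm S) (quadForm_smul S)
  refine ⟨C / c, by positivity, fun a hac had t ht => ?_⟩
  have hsymm : S.transpose = S := by simpa using hS.isHermitian.eq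
  have hV := le_exp_mul_of_deriv_le (f := fun t => a t ⬝ᵥ (S *ᵥ a t)) (c := 2 * δ)
    ((continuous_quadForm S).comp_continuousOn hac)
    (fun t ht => hasDerivAt_dotProduct (had t ht) (hasDerivAt_mulVec S (had t ht)))
    (fun t ht => by
      have e : (A *ᵥ a t) ⬝ᵥ (S *ᵥ a t) = a t ⬝ᵥ (S *ᵥ (A *ᵥ a t)) := by
        rw [dotProduct_mulVec (a t), ← mulVec_transpose, hsymm, dotProduct_comm]
      have := hA (a t)
      rw [← mulVec_mulVec] at this
      rw [e]
      linarith) ht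
  have h1 := hcS (a t)
  have h2 := hCS (a 0)
  rw [div_mul_eq_mul_div, div_mul_eq_mul_div, le_div_iff₀ hc]
  calc a t ⬝ᵥ a t * c = c * (a t ⬝ᵥ a t) := mul_comm _ _
    _ ≤ a t ⬝ᵥ (S *ᵥ a t) := h1
    _ ≤ Real.exp (-(2 * δ * t)) * (a 0 ⬝ᵥ (S *ᵥ a 0)) := hV
    _ ≤ Real.exp (-(2 * δ * t)) * (C * (a 0 ⬝ᵥ a 0)) :=
        mul_le_mul_of_nonneg_left h2 (Real.exp_pos _).le
    _ = C * Real.exp (-(2 * δ * t)) * (a 0 ⬝ᵥ a 0) := by ring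

end Quadratic

section Modes

variable {m : ℕ} [NeZero m] {d : Fin m → ℝ} {Q : Matrix (Fin m) (Fin m) ℝ}
  {Tbar : ℕ → Matrix (Fin m) (Fin m) ℝ}

/-- The design inequality bounds the quadratic form of `(Q - μ d_m I + B K_Q) P` for every
`μ ≥ λ₁`. -/
lemma DesignLMI.quadForm_le {δ lam₁ μ : ℝ} {P : Matrix (Fin m) (Fin m) ℝ}
    {J : Matrix (Fin 1) (Fin m) ℝ} (hd : 0 < d ⊤) (hP : P.PosDef)
    (h : DesignLMI d Q δ lam₁ P J) (hμ : lam₁ ≤ μ) (y : Fin m → ℝ) :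
    y ⬝ᵥ (((Q - (μ * d ⊤) • 1) * P + colB m * J) *ᵥ y) ≤ -δ * (y ⬝ᵥ (P *ᵥ y)) := by
  have hPy : 0 ≤ y ⬝ᵥ (P *ᵥ y) := by simpa using hP.posSemidef.dotProduct_mulVec_nonneg y
  have h1 : 0 ≤ y ⬝ᵥ (-(symPart (Q * P + colB m * J) + (δ - lam₁ * d ⊤) • P) *ᵥ y) := by
    simpa using (Matrix.PosDef.posSemidef h).dotProduct_mulVec_nonneg y
  rw [neg_mulVec, dotProduct_neg, add_mulVec, dotProduct_add, quadForm_symPart, smul_mulVec,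
    dotProduct_smul, smul_eq_mul] at h1
  have e : y ⬝ᵥ (((Q - (μ * d ⊤) • 1) * P + colB m * J) *ᵥ y) =
      y ⬝ᵥ ((Q * P + colB m * J) *ᵥ y) - μ * d ⊤ * (y ⬝ᵥ (P *ᵥ y)) := by
    rw [Matrix.sub_mul, Matrix.smul_mul, Matrix.one_mul, sub_add_eq_add_sub, sub_mulVec,
      dotProduct_sub, smul_mulVec, dotProduct_smul, smul_eq_mul]
  rw [e]
  have := mul_nonneg (mul_nonneg (sub_nonneg.2 hμ) hd.le) hPy
  linarith

/-- Each controlled mode decays, uniformly, with Lyapunov matrix `Tᵀ P⁻¹ T`. -/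
theorem SolvesSylvester.exists_decay (hT : SolvesSylvester d Q Tbar) {δ lam₁ μ : ℝ}
    {P : Matrix (Fin m) (Fin m) ℝ} {J : Matrix (Fin 1) (Fin m) ℝ} (hd : 0 < d ⊤)
    (hP : P.PosDef) (h : DesignLMI d Q δ lam₁ P J) (hμ : lam₁ ≤ μ) :
    ∃ C : ℝ, 0 < C ∧ ∀ a : ℝ → Fin m → ℝ, ContinuousOn a (Set.Ici 0) →
      (∀ t, 0 < t → HasDerivAt a ((Q - μ • Matrix.diagonal d +
        colB m * modeGain d Q Tbar (J * P⁻¹) μ) *ᵥ a t) t) →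
      ∀ t, 0 ≤ t → a t ⬝ᵥ a t ≤ C * Real.exp (-(2 * δ * t)) * (a 0 ⬝ᵥ a 0) := by
  have hconj := hT.transf_mul_closedLoop (J * P⁻¹) μ
  have hdet := hT.det_transf μ
  set T := transf d Tbar μ
  set A := Q - μ • Matrix.diagonal d + colB m * modeGain d Q Tbar (J * P⁻¹) μ
  set F := Q - (μ * d ⊤) • 1 + colB m * (J * P⁻¹) with hF
  have hPu : IsUnit P.det := (Matrix.isUnit_iff_isUnit_det _).1 hP.isUnit
  have hinj : Function.Injective T.mulVec :=
    Matrix.mulVec_injective_of_isUnit ((Matrix.isUnit_iff_isUnit_det _).2 (by rw [hdet]; simp))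
  have hS : (T.transpose * P⁻¹ * T).PosDef := by
    simpa using hP.inv.conjTranspose_mul_mul_same hinj
  have hPsymm : (P⁻¹).transpose = P⁻¹ := by simpa using hP.inv.isHermitian.eq
  refine exists_decay_of_lyapunov hS fun x => ?_
  set y := P⁻¹ *ᵥ (T *ᵥ x) with hy
  have hFP : F * P = (Q - (μ * d ⊤) • 1) * P + colB m * J := by
    rw [hF, Matrix.add_mul, Matrix.mul_assoc (colB m), Matrix.mul_assoc J,
      Matrix.nonsing_inv_mul _ hPu, Matrix.mul_one]
  have hPy : P *ᵥ y = T *ᵥ x := by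
    rw [hy, mulVec_mulVec, Matrix.mul_nonsing_inv _ hPu, one_mulVec]
  have hform : ∀ v, x ⬝ᵥ ((T.transpose * P⁻¹) *ᵥ v) = y ⬝ᵥ v := by
    intro v
    rw [dotProduct_mulVec, ← mulVec_transpose, Matrix.transpose_mul, Matrix.transpose_transpose,
      hPsymm, ← mulVec_mulVec]
  have e1 : x ⬝ᵥ ((T.transpose * P⁻¹ * T * A) *ᵥ x) = y ⬝ᵥ ((F * P) *ᵥ y) := by
    rw [Matrix.mul_assoc _ T A, hconj, ← mulVec_mulVec, hform, ← mulVec_mulVec, ← mulVec_mulVec,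
      hPy]
  have e2 : x ⬝ᵥ ((T.transpose * P⁻¹ * T) *ᵥ x) = y ⬝ᵥ (P *ᵥ y) := by
    rw [← mulVec_mulVec, hform, hPy]
  rw [e1, e2, hFP]
  exact h.quadForm_le hd hP hμ y

end Modes

/-! ### Feasibility of the design inequality -/

section Feasibility

variable {n : ℕ}

/-- The quadratic form of a matrix in terms of its first row, first column and the rest. -/
lemma quadForm_succ (M : Matrix (Fin (n + 1)) (Fin (n + 1)) ℝ) (x : Fin (n + 1) → ℝ) :
    x ⬝ᵥ (M *ᵥ x) = M 0 0 * x 0 ^ 2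
      + x 0 * ((fun i : Fin n => M 0 i.succ + M i.succ 0) ⬝ᵥ fun i => x i.succ)
      + (fun i : Fin n => x i.succ) ⬝ᵥ (M.submatrix Fin.succ Fin.succ *ᵥ fun i => x i.succ) := by
  simp only [dotProduct, mulVec, Fin.sum_univ_succ, submatrix_apply, mul_add, add_mul,
    Finset.sum_add_distrib, Finset.mul_sum]
  have e : ∀ i : Fin n, x i.succ * (M i.succ 0 * x 0) = x 0 * (M i.succ 0 * x i.succ) :=
    fun i => by ring
  simp only [e]
  ring

/-- If a quadratic form is positive on `{x₀ = 0}`, then adding a large multiple of `x₀²` makes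
it positive (a case of Finsler's lemma). -/
lemma exists_pos_add_mul_sq (M : Matrix (Fin (n + 1)) (Fin (n + 1)) ℝ)
    (hM : ∀ y : Fin n → ℝ, y ≠ 0 → 0 < y ⬝ᵥ (M.submatrix Fin.succ Fin.succ *ᵥ y)) :
    ∃ ρ : ℝ, ∀ x : Fin (n + 1) → ℝ, x ≠ 0 → 0 < x ⬝ᵥ (M *ᵥ x) + ρ * x 0 ^ 2 := by
  obtain ⟨c, hc, hcM⟩ := exists_mul_dotProduct_le (continuous_quadForm _) (quadForm_smul _) hM
  set l : Fin n → ℝ := fun i => M 0 i.succ + M i.succ 0 with hl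
  have hl0 : 0 ≤ l ⬝ᵥ l := Finset.sum_nonneg fun i _ => mul_self_nonneg (l i)
  refine ⟨1 - M 0 0 + (l ⬝ᵥ l + 1) / (2 * c), fun x hx => ?_⟩
  rw [quadForm_succ, ← hl]
  set y : Fin n → ℝ := fun i => x i.succ with hy
  have hy0 : 0 ≤ y ⬝ᵥ y := Finset.sum_nonneg fun i _ => mul_self_nonneg (y i)
  have hcs : (l ⬝ᵥ y) ^ 2 ≤ (l ⬝ᵥ l + 1) * (y ⬝ᵥ y) := by
    have h1 := Finset.sum_mul_sq_le_sq_mul_sq Finset.univ l y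
    have h2 : ∑ i, l i ^ 2 = l ⬝ᵥ l := by simp [dotProduct, sq]
    have h3 : ∑ i, y i ^ 2 = y ⬝ᵥ y := by simp [dotProduct, sq]
    rw [h2, h3] at h1
    have h4 : l ⬝ᵥ y = ∑ i, l i * y i := rfl
    rw [h4]
    nlinarith
  have hmain := hcM y
  have hpos : 0 < x 0 ^ 2 + c / 2 * (y ⬝ᵥ y) := by
    by_cases h0 : x 0 = 0
    · have : y ≠ 0 := by
        intro hy'
        apply hx
        ext i
        refine Fin.cases h0 (fun j => ?_) i
        exact congrFun hy' j
      have := dotProduct_self_pos this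
      positivity
    · have : 0 < x 0 ^ 2 := by positivity
      positivity
  set Λ := l ⬝ᵥ l + 1 with hΛ
  have hΛpos : 0 < Λ := by positivity
  have hcross : -(Λ / (2 * c) * x 0 ^ 2) - c / 2 * (y ⬝ᵥ y) ≤ x 0 * (l ⬝ᵥ y) := by
    have h1 : -(Λ / (2 * c) * x 0 ^ 2) - c / (2 * Λ) * (l ⬝ᵥ y) ^ 2 ≤ x 0 * (l ⬝ᵥ y) := by
      have : 0 ≤ (Λ * x 0 + c * (l ⬝ᵥ y)) ^ 2 / (2 * c * Λ) := by positivity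
      have e : (Λ * x 0 + c * (l ⬝ᵥ y)) ^ 2 / (2 * c * Λ) =
          Λ / (2 * c) * x 0 ^ 2 + x 0 * (l ⬝ᵥ y) + c / (2 * Λ) * (l ⬝ᵥ y) ^ 2 := by
        field_simp
        ring
      linarith
    have h2 : c / (2 * Λ) * (l ⬝ᵥ y) ^ 2 ≤ c / (2 * Λ) * (Λ * (y ⬝ᵥ y)) :=
      mul_le_mul_of_nonneg_left hcs (by positivity)
    have h3 : c / (2 * Λ) * (Λ * (y ⬝ᵥ y)) = c / 2 * (y ⬝ᵥ y) := by field_simp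
    linarith
  nlinarith

/-- The symmetric matrix with corner `p`, first row and column `q` and remaining block `P`. -/
def bordered (p : ℝ) (q : Fin n → ℝ) (P : Matrix (Fin n) (Fin n) ℝ) :
    Matrix (Fin (n + 1)) (Fin (n + 1)) ℝ :=
  Matrix.of (Fin.cons (Fin.cons p q) fun i => Fin.cons (q i) (P i))

@[simp] lemma bordered_zero_zero (p : ℝ) (q : Fin n → ℝ) (P : Matrix (Fin n) (Fin n) ℝ) :
    bordered p q P 0 0 = p := rfl
@[simp] lemma bordered_zero_succ (p : ℝ) (q : Fin n → ℝ) (P : Matrix (Fin n) (Fin n) ℝ)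
    (j : Fin n) : bordered p q P 0 j.succ = q j := rfl
@[simp] lemma bordered_succ_zero (p : ℝ) (q : Fin n → ℝ) (P : Matrix (Fin n) (Fin n) ℝ)
    (i : Fin n) : bordered p q P i.succ 0 = q i := rfl
@[simp] lemma bordered_succ_succ (p : ℝ) (q : Fin n → ℝ) (P : Matrix (Fin n) (Fin n) ℝ)
    (i j : Fin n) : bordered p q P i.succ j.succ = P i j := rfl

lemma bordered_submatrix (p : ℝ) (q : Fin n → ℝ) (P : Matrix (Fin n) (Fin n) ℝ) :
    (bordered p q P).submatrix Fin.succ Fin.succ = P := rfl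

lemma exists_posDef_bordered (q : Fin n → ℝ) {P : Matrix (Fin n) (Fin n) ℝ} (hP : P.PosDef) :
    ∃ p : ℝ, (bordered p q P).PosDef := by
  obtain ⟨p, hp⟩ := exists_pos_add_mul_sq (bordered 0 q P)
    fun y hy => by rw [bordered_submatrix]; exact posDef_quadForm_pos hP hy
  refine ⟨p, Matrix.PosDef.of_dotProduct_mulVec_pos ?_ fun x hx => ?_⟩
  · ext i j
    refine Fin.cases ?_ (fun i => ?_) i <;> refine Fin.cases ?_ (fun j => ?_) j
    · simp
    · simp
    · simp
    · simpa using hP.isHermitian.apply i j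
  · have h1 := hp x hx
    rw [quadForm_succ] at h1
    rw [star_trivial, quadForm_succ]
    simp only [bordered_zero_zero, bordered_zero_succ, bordered_succ_zero,
      bordered_submatrix] at h1 ⊢
    linarith

/-- For a Hessenberg matrix `A` with nonzero subdiagonal there is `P ≻ 0` for which the form of
`A P` is negative on `{x₀ = 0}`.  By induction on the size: on `{x₀ = 0}` the form of `A P` is the
one of `A' P'` plus `a₂₁ x₁ (q · x)`, where `A'`, `P'` are the lower right blocks and `q` is the
rest of the first row of `P`, so `q` plays the part of a control for the smaller matrix, and the
corner of `P` is free to make `P` positive definite. -/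
lemma exists_posDef_quadForm_neg : ∀ (n : ℕ) (A : Matrix (Fin (n + 1)) (Fin (n + 1)) ℝ),
    IsReactionMatrix A → SubdiagonalNonzero A → ∃ P : Matrix (Fin (n + 1)) (Fin (n + 1)) ℝ,
      P.PosDef ∧ ∀ y : Fin n → ℝ, y ≠ 0 →
        0 < y ⬝ᵥ ((-(A * P)).submatrix Fin.succ Fin.succ *ᵥ y) := by
  intro n
  induction n with
  | zero => exact fun A _ _ => ⟨1, Matrix.PosDef.one, fun y hy => (hy (Subsingleton.elim _ _)).elim⟩
  | succ n ih =>
    intro A hA hsub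
    set A' := A.submatrix Fin.succ Fin.succ with hA'
    obtain ⟨P', hP', hneg⟩ := ih A'
      (fun i j hij => hA i.succ j.succ (by simpa using hij))
      (fun i j hij => hsub i.succ j.succ (by simpa using hij))
    obtain ⟨ρ, hρ⟩ := exists_pos_add_mul_sq (-(A' * P')) hneg
    have hb : A 1 0 ≠ 0 := hsub 1 0 (by simp)
    obtain ⟨p, hp⟩ := exists_posDef_bordered (Fin.cons (-(ρ / A 1 0)) 0 : Fin (n + 1) → ℝ) hP'
    refine ⟨_, hp, fun y hy => ?_⟩
    refine (hρ y hy).trans_eq ?_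
    set q : Fin (n + 1) → ℝ := Fin.cons (-(ρ / A 1 0)) 0 with hq
    have hblock : (-(A * bordered p q P')).submatrix Fin.succ Fin.succ =
        -(A' * P') - Matrix.of fun i k => A i.succ 0 * q k := by
      ext i k
      simp only [submatrix_apply, Matrix.neg_apply, Matrix.sub_apply, of_apply, Matrix.mul_apply,
        Fin.sum_univ_succ (n := n + 1), bordered_zero_succ, bordered_succ_succ, hA']
      ring
    have hA0 : ∀ i : Fin n, A i.succ.succ 0 = 0 := fun i => hA _ _ (by simp)
    have hcorner : y ⬝ᵥ ((Matrix.of fun i k => A i.succ 0 * q k) *ᵥ y) = -ρ * y 0 ^ 2 := by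
      simp only [dotProduct, mulVec, of_apply, Fin.sum_univ_succ, hA0, hq, Fin.cons_zero,
        Fin.cons_succ, Pi.zero_apply, zero_mul, mul_zero, Finset.sum_const_zero, add_zero]
      rw [show (Fin.succ 0 : Fin (n + 2)) = 1 from rfl]
      field_simp
    rw [hblock, sub_mulVec, dotProduct_sub, hcorner]
    ring

/-- Feasibility of the design inequality, for every shift. -/
theorem exists_designLMI {m : ℕ} [NeZero m] (d : Fin m → ℝ) {Q : Matrix (Fin m) (Fin m) ℝ}
    (hQ : IsReactionMatrix Q) (hctrl : SubdiagonalNonzero Q) (δ lam₁ : ℝ) :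
    ∃ (P : Matrix (Fin m) (Fin m) ℝ) (J : Matrix (Fin 1) (Fin m) ℝ), P.PosDef ∧
      DesignLMI d Q δ lam₁ P J := by
  obtain ⟨n, rfl⟩ := Nat.exists_eq_succ_of_ne_zero (NeZero.ne m)
  set c := δ - lam₁ * d ⊤ with hc
  set A := Q + c • (1 : Matrix (Fin (n + 1)) (Fin (n + 1)) ℝ) with hA
  have hoff : ∀ i j, i ≠ j → A i j = Q i j := fun i j hij => by simp [hA, Matrix.one_apply_ne hij]
  obtain ⟨P, hP, hneg⟩ := exists_posDef_quadForm_neg n A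
    (fun i j hij => by
      rw [hoff i j (fun h => by subst h; omega)]; exact hQ i j hij)
    (fun i j hij => by
      rw [hoff i j (fun h => by subst h; omega)]; exact hctrl i j hij)
  obtain ⟨ρ, hρ⟩ := exists_pos_add_mul_sq (-(A * P)) hneg
  have hsymm : P.transpose = P := by simpa using hP.isHermitian.eq
  refine ⟨P, -ρ • (colB (n + 1)).transpose, hP, ?_⟩
  have hform : ∀ x : Fin (n + 1) → ℝ,
      x ⬝ᵥ (-(symPart (Q * P + colB (n + 1) * (-ρ • (colB (n + 1)).transpose)) + c • P) *ᵥ x) =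
        x ⬝ᵥ (-(A * P) *ᵥ x) + ρ * x 0 ^ 2 := by
    intro x
    have hcol : x ⬝ᵥ ((colB (n + 1) * (colB (n + 1)).transpose) *ᵥ x) = x 0 ^ 2 := by
      rw [← mulVec_mulVec, dotProduct_mulVec]
      have e : (colB (n + 1)).transpose *ᵥ x = fun _ => x 0 := by
        ext i; simp [colB, mulVec, dotProduct]
      have e' : x ᵥ* colB (n + 1) = fun _ => x 0 := by
        rw [← mulVec_transpose, e]
      rw [e, e']
      simp [dotProduct, sq]
    rw [neg_mulVec, dotProduct_neg, add_mulVec, dotProduct_add, quadForm_symPart, add_mulVec,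
      dotProduct_add, Matrix.mul_smul, smul_mulVec (-ρ), dotProduct_smul, hcol, hA,
      Matrix.add_mul, Matrix.smul_mul, Matrix.one_mul, neg_mulVec, dotProduct_neg, add_mulVec,
      dotProduct_add, smul_eq_mul]
    ring
  refine Matrix.PosDef.of_dotProduct_mulVec_pos ?_ fun x hx => ?_
  · rw [← hc, Matrix.IsHermitian, conjTranspose_eq_transpose_of_trivial, transpose_neg,
      transpose_add, transpose_smul, hsymm, symPart, transpose_smul, transpose_add,
      transpose_transpose, add_comm (Matrix.transpose _)]
  · rw [star_trivial, ← hc, hform]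
    exact hρ x hx

end Feasibility

/-! ### Modal coefficients of the state -/

section Coefficients

variable {m : ℕ} {L : ℝ} {γ : Matrix (Fin 2) (Fin 2) ℝ} {lam : ℕ → ℝ} {φ : ℕ → ℝ → ℝ}

/-- The `i`-th component of a state. -/
def component (m : ℕ) (L : ℝ) (i : Fin m) : StateSpace m L →L[ℝ] ScalarSpace L :=
  (EuclideanSpace.proj i : EuclideanSpace ℝ (Fin m) →L[ℝ] ℝ).compLpL 2
    (volume.restrict (Set.Ioo 0 L))

lemma coeFn_component (i : Fin m) (f : StateSpace m L) :
    ∀ᵐ x ∂(volume.restrict (Set.Ioo 0 L)), component m L i f x = f x i :=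
  ContinuousLinearMap.coeFn_compLp _ f

lemma inner_eq_sum_component (f g : StateSpace m L) :
    inner ℝ f g = ∑ i, inner ℝ (component m L i f) (component m L i g) := by
  simp only [L2.inner_def]
  rw [← integral_finsetSum _ fun i _ => L2.integrable_inner (𝕜 := ℝ) _ _]
  apply integral_congr_ae
  have h : ∀ᵐ x ∂(volume.restrict (Set.Ioo 0 L)), ∀ i,
      component m L i f x = f x i ∧ component m L i g x = g x i :=
    ae_all_iff.2 fun i => (coeFn_component i f).and (coeFn_component i g)
  filter_upwards [h] with x hx
  rw [PiLp.inner_apply]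
  exact Finset.sum_congr rfl fun i _ => by rw [(hx i).1, (hx i).2]

/-- The coefficients of the components of a state with respect to the `n`-th basis vector. -/
def coefficient (e : HilbertBasis ℕ ℝ (ScalarSpace L)) (n : ℕ) (f : StateSpace m L) :
    Fin m → ℝ :=
  fun i => inner ℝ (e n) (component m L i f)

lemma continuous_coefficient (e : HilbertBasis ℕ ℝ (ScalarSpace L)) (n : ℕ) :
    Continuous (coefficient (m := m) e n) :=
  continuous_pi fun i => continuous_const.inner (component m L i).continuous

lemma hasDerivAt_coefficient (e : HilbertBasis ℕ ℝ (ScalarSpace L)) (n : ℕ)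
    {z : ℝ → StateSpace m L} {z' : StateSpace m L} {t : ℝ} (h : HasDerivAt z z' t) :
    HasDerivAt (fun s => coefficient e n (z s)) (coefficient e n z') t :=
  hasDerivAt_pi.2 fun i =>
    ((innerSL ℝ (e n)).comp (component m L i)).hasFDerivAt.comp_hasDerivAt t h

/-- Parseval's identity for vector-valued states. -/
lemma hasSum_coefficient (e : HilbertBasis ℕ ℝ (ScalarSpace L)) (f g : StateSpace m L) :
    HasSum (fun n => coefficient e n f ⬝ᵥ coefficient e n g) (inner ℝ f g) := by
  rw [inner_eq_sum_component]
  refine hasSum_sum fun i _ => ?_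
  have := e.hasSum_inner_mul_inner (component m L i f) (component m L i g)
  simpa [coefficient, real_inner_comm] using this

lemma modes_eq_coefficient (hL : 0 ≤ L) {e : HilbertBasis ℕ ℝ (ScalarSpace L)}
    (he : ∀ n, ∀ᵐ x ∂(volume.restrict (Set.Ioo 0 L)), e n x = φ n x) (N : ℕ)
    (f : StateSpace m L) (p : Fin N × Fin m) : modes N φ f p = coefficient e p.1 f p.2 := by
  rw [modes, coefficient, ScalarSpace.inner_eq hL, intervalIntegral_eq_integral_Ioo hL,
    intervalIntegral_eq_integral_Ioo hL]
  apply integral_congr_ae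
  filter_upwards [he p.1, coeFn_component p.2 f] with x h1 h2
  rw [h1, h2, mul_comm]

/-- The components of the vector-valued second derivative are scalar second derivatives. -/
lemma HasSecondDerivBC.exists_isDomainFunction (hL : 0 ≤ L) {f g : StateSpace m L}
    (h : HasSecondDerivBC γ f g) (i : Fin m) :
    ∃ v v₁, (∀ᵐ x ∂(volume.restrict (Set.Ioo 0 L)), component m L i f x = v x) ∧
      IsDomainFunction L γ v v₁ (component m L i g) := by
  obtain ⟨v, v₁, hfv, hv, hv₁, h0, hL'⟩ := h
  have ig : IntervalIntegrable g volume 0 L := by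
    rw [intervalIntegrable_iff_integrableOn_Ioo_of_le hL]
    exact (Lp.memLp g).integrable one_le_two
  have sub : ∀ x ∈ Set.Icc 0 L, Set.uIcc 0 x ⊆ Set.uIcc 0 L := fun x hx => by
    rw [Set.uIcc_of_le hx.1, Set.uIcc_of_le hL]
    exact Set.Icc_subset_Icc le_rfl hx.2
  have cv₁ : ContinuousOn v₁ (Set.Icc 0 L) := by
    have h2 := intervalIntegral.continuousOn_primitive_interval
      ((intervalIntegrable_iff' (by simp)).1 ig)
    rw [Set.uIcc_of_le hL] at h2
    exact (h2.const_add (v₁ 0)).congr hv₁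
  have iv₁ : IntervalIntegrable v₁ volume 0 L :=
    ContinuousOn.intervalIntegrable (by rwa [Set.uIcc_of_le hL])
  let pr : EuclideanSpace ℝ (Fin m) →L[ℝ] ℝ := EuclideanSpace.proj i
  have pint : ∀ {F : ℝ → EuclideanSpace ℝ (Fin m)}, IntervalIntegrable F volume 0 L →
      ∀ x ∈ Set.Icc 0 L, (∫ y in (0 : ℝ)..x, F y) i = ∫ y in (0 : ℝ)..x, F y i :=
    fun hF x hx => (pr.intervalIntegral_comp_comm (hF.mono_set (sub x hx))).symm
  have icomp : ∀ {F : ℝ → EuclideanSpace ℝ (Fin m)}, IntervalIntegrable F volume 0 L →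
      IntervalIntegrable (fun y => F y i) volume 0 L :=
    fun hF => ⟨pr.integrable_comp hF.1, pr.integrable_comp hF.2⟩
  refine ⟨fun x => v x i, fun x => v₁ x i, ?_, ⟨icomp iv₁, fun x hx => ?_⟩, ?_, ?_, ?_⟩
  · filter_upwards [hfv, coeFn_component i f] with x h1 h2
    rw [h2, h1]
  · rw [← pint iv₁ x hx]
    exact congrArg (fun w : EuclideanSpace ℝ (Fin m) => w i) (hv x hx)
  · refine IsPrimitive.congr_ae (f := fun x => g x i) hL ⟨icomp ig, fun x hx => ?_⟩ ?_
    · rw [← pint ig x hx]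
      exact congrArg (fun w : EuclideanSpace ℝ (Fin m) => w i) (hv₁ x hx)
    · filter_upwards [coeFn_component i g] with x hx
      exact hx.symm
  · exact congrArg (fun w : EuclideanSpace ℝ (Fin m) => w i) h0
  · exact congrArg (fun w : EuclideanSpace ℝ (Fin m) => w i) hL'

/-- The second derivative acts on the coefficients as multiplication by `-λ_n`. -/
lemma HasSecondDerivBC.coefficient_eq (hL : 0 ≤ L) (hγ : ∀ i, γ i 0 ^ 2 + γ i 1 ^ 2 ≠ 0)
    (hφ : IsEigensystem L γ lam φ) {e : HilbertBasis ℕ ℝ (ScalarSpace L)}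
    (he : ∀ n, ∀ᵐ x ∂(volume.restrict (Set.Ioo 0 L)), e n x = φ n x) {f g : StateSpace m L}
    (h : HasSecondDerivBC γ f g) (n : ℕ) :
    coefficient e n g = -lam n • coefficient e n f := by
  ext i
  obtain ⟨v, v₁, hfv, hv⟩ := h.exists_isDomainFunction hL i
  obtain ⟨φ', hn⟩ := (hφ.eigenfunction n).exists_isDomainFunction hL
  have key := hv.integral_symm hL hγ hn
  have e1 : ∀ x, v x * -(lam n * φ n x) = -lam n * (φ n x * v x) := fun x => by ring
  simp only [e1, intervalIntegral.integral_const_mul] at key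
  rw [Pi.smul_apply, coefficient, coefficient, ScalarSpace.inner_eq hL, ScalarSpace.inner_eq hL,
    smul_eq_mul]
  have a1 : ∫ x in (0 : ℝ)..L, e n x * component m L i g x =
      ∫ x in (0 : ℝ)..L, component m L i g x * φ n x := by
    rw [intervalIntegral_eq_integral_Ioo hL, intervalIntegral_eq_integral_Ioo hL]
    apply integral_congr_ae
    filter_upwards [he n] with x hx
    rw [hx, mul_comm]
  have a2 : ∫ x in (0 : ℝ)..L, e n x * component m L i f x =
      ∫ x in (0 : ℝ)..L, φ n x * v x := by
    rw [intervalIntegral_eq_integral_Ioo hL, intervalIntegral_eq_integral_Ioo hL]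
    apply integral_congr_ae
    filter_upwards [he n, hfv] with x h1 h2
    rw [h1, h2]
  rw [a1, a2, key]

variable {N : ℕ} {b : Fin N → ℝ → ℝ}

/-- The control profile `∑ⱼ uⱼ bⱼ` as an element of `L²(0, L)`. -/
def controlProfile (hb : ∀ j, MemLp (b j) 2 (volume.restrict (Set.Ioo 0 L))) (u : Fin N → ℝ) :
    ScalarSpace L :=
  ∑ j, u j • (hb j).toLp (b j)

lemma coeFn_controlProfile (hb : ∀ j, MemLp (b j) 2 (volume.restrict (Set.Ioo 0 L)))
    (u : Fin N → ℝ) :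
    ∀ᵐ x ∂(volume.restrict (Set.Ioo 0 L)), controlProfile hb u x = ∑ j, b j x * u j := by
  have h1 : ∀ᵐ x ∂(volume.restrict (Set.Ioo 0 L)), ∀ j,
      (u j • (hb j).toLp (b j) : ScalarSpace L) x = b j x * u j := by
    refine ae_all_iff.2 fun j => ?_
    filter_upwards [Lp.coeFn_smul (u j) ((hb j).toLp (b j)), (hb j).coeFn_toLp] with x h1 h2
    rw [h1, Pi.smul_apply, h2, smul_eq_mul, mul_comm]
  filter_upwards [Lp.coeFn_finsetSum Finset.univ fun j => (u j • (hb j).toLp (b j) : ScalarSpace L),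
    h1] with x hx h1
  rw [controlProfile, hx, Finset.sum_apply]
  exact Finset.sum_congr rfl fun j _ => h1 j

lemma inner_controlProfile (hL : 0 ≤ L) {e : HilbertBasis ℕ ℝ (ScalarSpace L)}
    (he : ∀ n, ∀ᵐ x ∂(volume.restrict (Set.Ioo 0 L)), e n x = φ n x)
    (hb : ∀ j, MemLp (b j) 2 (volume.restrict (Set.Ioo 0 L))) (u : Fin N → ℝ) (n : Fin N) :
    inner ℝ (e n) (controlProfile hb u) = (projMatrix L φ b *ᵥ u) n := by
  rw [controlProfile, inner_sum, mulVec, dotProduct]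
  refine Finset.sum_congr rfl fun j _ => ?_
  rw [inner_smul_right, mul_comm, ScalarSpace.inner_eq hL, intervalIntegral_eq_integral_Ioo hL,
    projMatrix, of_apply, intervalIntegral_eq_integral_Ioo hL]
  congr 1
  apply integral_congr_ae
  filter_upwards [he n, (hb j).coeFn_toLp] with x h1 h2
  rw [h1, h2, mul_comm]

/-- The `L²` norm of the control profile is bounded by the controlled modes. -/
lemma exists_controlProfile_le (hL : 0 ≤ L) {e : HilbertBasis ℕ ℝ (ScalarSpace L)}
    (he : ∀ n, ∀ᵐ x ∂(volume.restrict (Set.Ioo 0 L)), e n x = φ n x)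
    (hb : ∀ j, MemLp (b j) 2 (volume.restrict (Set.Ioo 0 L)))
    (K : Matrix (Fin N) (Fin N × Fin m) ℝ) :
    ∃ C : ℝ, 0 < C ∧ ∀ f : StateSpace m L, ‖controlProfile hb (K *ᵥ modes N φ f)‖ ^ 2 ≤
      C * ∑ n ∈ Finset.range N, coefficient e n f ⬝ᵥ coefficient e n f := by
  obtain ⟨C, hC, hCq⟩ := exists_le_mul_dotProduct
    (q := fun Z : Fin N × Fin m → ℝ => ‖controlProfile hb (K *ᵥ Z)‖ ^ 2)
    (by unfold controlProfile; fun_prop)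
    (fun c Z => by
      have : controlProfile hb (K *ᵥ (c • Z)) = c • controlProfile hb (K *ᵥ Z) := by
        rw [mulVec_smul, controlProfile, controlProfile, Finset.smul_sum]
        exact Finset.sum_congr rfl fun j _ => by rw [Pi.smul_apply, smul_eq_mul, mul_smul]
      simp only [this, norm_smul, mul_pow, Real.norm_eq_abs, sq_abs])
  refine ⟨C, hC, fun f => (hCq _).trans_eq ?_⟩
  congr 1
  simp only [dotProduct, modes_eq_coefficient hL he, Fintype.sum_prod_type]
  exact Fin.sum_univ_eq_sum_range
    (fun n => ∑ i, coefficient e n f i * coefficient e n f i) N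

/-- The ordinary differential equation of the `n`-th mode. -/
lemma IsSolution.exists_hasDerivAt [NeZero m] {d : Fin m → ℝ} {Q : Matrix (Fin m) (Fin m) ℝ}
    (hL : 0 ≤ L) (hγ : ∀ i, γ i 0 ^ 2 + γ i 1 ^ 2 ≠ 0)
    (hφ : IsEigensystem L γ lam φ) {e : HilbertBasis ℕ ℝ (ScalarSpace L)}
    (he : ∀ n, ∀ᵐ x ∂(volume.restrict (Set.Ioo 0 L)), e n x = φ n x)
    (hb : ∀ j, MemLp (b j) 2 (volume.restrict (Set.Ioo 0 L))) {u : ℝ → Fin N → ℝ}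
    {z₀ : StateSpace m L} {z : ℝ → StateSpace m L} (hz : IsSolution γ d Q b u z₀ z) {t : ℝ}
    (ht : 0 < t) :
    ∃ zt : StateSpace m L, HasDerivAt z zt t ∧ ∀ n, coefficient e n zt =
      (Q - lam n • Matrix.diagonal d) *ᵥ coefficient e n (z t) +
        colB m *ᵥ fun _ => inner ℝ (e n) (controlProfile hb (u t)) := by
  obtain ⟨zt, zxx, hder, hxx, heq⟩ := hz.equation t ht
  refine ⟨zt, hder, fun n => ?_⟩
  have hcxx := hxx.coefficient_eq hL hγ hφ he n
  have hcomp : ∀ i, component m L i zt = d i • component m L i zxx +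
      ∑ k, Q i k • component m L k (z t) + colB m i 0 • controlProfile hb (u t) := by
    intro i
    refine Lp.ext ?_
    have h1 : ∀ᵐ x ∂(volume.restrict (Set.Ioo 0 L)), ∀ k,
        (Q i k • component m L k (z t) : ScalarSpace L) x = Q i k * z t x k := by
      refine ae_all_iff.2 fun k => ?_
      filter_upwards [Lp.coeFn_smul (Q i k) (component m L k (z t)), coeFn_component k (z t)]
        with x h1 h2
      rw [h1, Pi.smul_apply, h2, smul_eq_mul]
    filter_upwards [heq, coeFn_component i zt, coeFn_component i zxx, h1,
      coeFn_controlProfile hb (u t),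
      Lp.coeFn_add (d i • component m L i zxx + ∑ k, Q i k • component m L k (z t))
        (colB m i 0 • controlProfile hb (u t)),
      Lp.coeFn_add (d i • component m L i zxx) (∑ k, Q i k • component m L k (z t)),
      Lp.coeFn_smul (d i) (component m L i zxx),
      Lp.coeFn_smul (colB m i 0) (controlProfile hb (u t)),
      Lp.coeFn_finsetSum Finset.univ fun k => (Q i k • component m L k (z t) : ScalarSpace L)]
      with x h0 h1 h2 h3 h4 h5 h6 h7 h8 h9
    rw [h1, h0 i, h5, Pi.add_apply, h6, Pi.add_apply, h7, h8, h9, Pi.smul_apply, Pi.smul_apply,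
      Finset.sum_apply, h2, h4, smul_eq_mul, smul_eq_mul]
    simp only [h3]
  ext i
  have hi := congrFun hcxx i
  simp only [coefficient, Pi.smul_apply, smul_eq_mul] at hi
  rw [coefficient, hcomp i, inner_add_right, inner_add_right, inner_smul_right, inner_smul_right,
    inner_sum, hi]
  simp only [inner_smul_right, Pi.add_apply, sub_mulVec, smul_mulVec, Pi.sub_apply,
    Pi.smul_apply, mulVec_diagonal, smul_eq_mul]
  simp only [mulVec, dotProduct, coefficient, Finset.univ_unique, Finset.sum_singleton]
  simp only [Fin.default_eq_zero]
  ring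

end Coefficients

/-! ### The closed loop -/

section ClosedLoop

variable {m N : ℕ} [NeZero m] {L : ℝ} {γ : Matrix (Fin 2) (Fin 2) ℝ} {lam : ℕ → ℝ}
  {φ : ℕ → ℝ → ℝ} {d : Fin m → ℝ} {Q : Matrix (Fin m) (Fin m) ℝ} {b : Fin N → ℝ → ℝ}
  {Tbar : ℕ → Matrix (Fin m) (Fin m) ℝ} {δ : ℝ}

/-- The gain decouples the first `N` modes: the control enters the `n`-th one through
`K̄_n z_n`. -/
lemma projMatrix_mulVec_gain (hB : IsUnit (projMatrix L φ b).det) (KQ : Matrix (Fin 1) (Fin m) ℝ)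
    (Z : Fin N × Fin m → ℝ) (n : Fin N) :
    (projMatrix L φ b *ᵥ (gain L d Q lam φ b Tbar KQ *ᵥ Z)) n =
      (modeGain d Q Tbar KQ (lam n) *ᵥ fun i => Z (n, i)) 0 := by
  -- The product in the definition of `gain` is elaborated as one of `CStarMatrix`, a type synonym.
  have hgain : gain L d Q lam φ b Tbar KQ = @HMul.hMul _ _ _
      Matrix.instHMulOfFintypeOfMulOfAddCommMonoid (projMatrix L φ b)⁻¹
      (blkdiagRows fun n => modeGain d Q Tbar KQ (lam n)) := rfl
  rw [hgain, mulVec_mulVec, ← Matrix.mul_assoc, Matrix.mul_nonsing_inv _ hB, Matrix.one_mul]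
  simp [mulVec, dotProduct, blkdiagRows, Fintype.sum_prod_type]

/-- The forcing of a high mode is absorbed by half of the coercivity constant `ε`. -/
lemma dotProduct_highMode_le {ε μ μ₀ : ℝ} (hε : 0 < ε) (hd : ∀ i, 0 < d i)
    (hneg : ∀ x : Fin m → ℝ, ε * (x ⬝ᵥ x) ≤
      x ⬝ᵥ (-(-(μ₀ • Matrix.diagonal d) + symPart Q + δ • 1) *ᵥ x)) (hμ : μ₀ ≤ μ)
    (a : Fin m → ℝ) (β : ℝ) :
    a ⬝ᵥ ((Q - μ • Matrix.diagonal d) *ᵥ a + colB m *ᵥ fun _ => β) ≤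
      -(δ + ε / 2) * (a ⬝ᵥ a) + (2 * ε)⁻¹ * β ^ 2 := by
  have h1 := hneg a
  rw [neg_mulVec, dotProduct_neg, add_mulVec, add_mulVec, dotProduct_add, dotProduct_add,
    neg_mulVec, dotProduct_neg, quadForm_symPart, smul_mulVec, dotProduct_smul, smul_mulVec,
    dotProduct_smul, one_mulVec, smul_eq_mul, smul_eq_mul] at h1
  have hD : 0 ≤ a ⬝ᵥ (Matrix.diagonal d *ᵥ a) := by
    simp only [dotProduct, mulVec_diagonal]
    exact Finset.sum_nonneg fun i _ => by nlinarith [hd i, mul_self_nonneg (a i)]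
  have h2 : a ⬝ᵥ (colB m *ᵥ fun _ => β) = a 0 * β := by
    simp [colB, mulVec, dotProduct]
  have h3 : a 0 * a 0 ≤ a ⬝ᵥ a :=
    Finset.single_le_sum (f := fun i => a i * a i) (fun j _ => mul_self_nonneg _)
      (Finset.mem_univ 0)
  have h4 : a 0 * β ≤ ε / 2 * (a 0 * a 0) + (2 * ε)⁻¹ * β ^ 2 := by
    have : 0 ≤ (ε * a 0 - β) ^ 2 / (2 * ε) := by positivity
    have e : (ε * a 0 - β) ^ 2 / (2 * ε) = ε / 2 * (a 0 * a 0) + (2 * ε)⁻¹ * β ^ 2 - a 0 * β := by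
      field_simp
      ring
    linarith
  rw [dotProduct_add, h2, sub_mulVec, dotProduct_sub, smul_mulVec, dotProduct_smul, smul_eq_mul]
  have h5 := mul_nonneg (sub_nonneg.2 hμ) hD
  have h6 := mul_le_mul_of_nonneg_left h3 (half_pos hε).le
  linarith

/-- Uniform exponential decay of the first `N` modes of all closed-loop solutions. -/
lemma exists_lowMode_decay (hL : 0 ≤ L) (hγ : ∀ i, γ i 0 ^ 2 + γ i 1 ^ 2 ≠ 0) (hd : ∀ i, 0 < d i)
    (hφ : IsEigensystem L γ lam φ) {e : HilbertBasis ℕ ℝ (ScalarSpace L)}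
    (he : ∀ n, ∀ᵐ x ∂(volume.restrict (Set.Ioo 0 L)), e n x = φ n x)
    (hb : ∀ j, MemLp (b j) 2 (volume.restrict (Set.Ioo 0 L)))
    (hB : IsUnit (projMatrix L φ b).det) (hT : SolvesSylvester d Q Tbar)
    {P : Matrix (Fin m) (Fin m) ℝ} {J : Matrix (Fin 1) (Fin m) ℝ} (hP : P.PosDef)
    (hJ : DesignLMI d Q δ (lam 0) P J) :
    ∃ C : ℝ, 0 < C ∧ ∀ (z₀ : StateSpace m L) (z : ℝ → StateSpace m L),
      IsSolution γ d Q b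
        (fun t => gain L d Q lam φ b Tbar (J * P⁻¹) *ᵥ modes N φ (z t)) z₀ z →
      ∀ t : ℝ, 0 ≤ t →
        ∑ n ∈ Finset.range N, coefficient e n (z t) ⬝ᵥ coefficient e n (z t) ≤
          C * Real.exp (-(2 * δ * t)) * ‖z₀‖ ^ 2 := by
  have hmode : ∀ n : ℕ, ∃ C : ℝ, 0 < C ∧ ∀ a : ℝ → Fin m → ℝ, ContinuousOn a (Set.Ici 0) →
      (∀ t, 0 < t → HasDerivAt a ((Q - lam n • Matrix.diagonal d +
        colB m * modeGain d Q Tbar (J * P⁻¹) (lam n)) *ᵥ a t) t) →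
      ∀ t, 0 ≤ t → a t ⬝ᵥ a t ≤ C * Real.exp (-(2 * δ * t)) * (a 0 ⬝ᵥ a 0) := fun n =>
    hT.exists_decay (hd ⊤) hP hJ (hφ.strictMono.monotone (Nat.zero_le n))
  choose C hC hCdecay using hmode
  refine ⟨1 + ∑ n ∈ Finset.range N, C n,
    add_pos_of_pos_of_nonneg one_pos (Finset.sum_nonneg fun n _ => (hC n).le),
    fun z₀ z hz t ht => ?_⟩
  have hnonneg : ∀ n, 0 ≤ coefficient e n z₀ ⬝ᵥ coefficient e n z₀ := fun n =>
    Finset.sum_nonneg fun i _ => mul_self_nonneg _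
  have hbessel : ∀ n, coefficient e n z₀ ⬝ᵥ coefficient e n z₀ ≤ ‖z₀‖ ^ 2 := fun n => by
    rw [← real_inner_self_eq_norm_sq]
    exact le_hasSum (hasSum_coefficient e z₀ z₀) n fun k _ => hnonneg k
  have hexp := (Real.exp_pos (-(2 * δ * t))).le
  have hz0 := sq_nonneg ‖z₀‖
  calc ∑ n ∈ Finset.range N, coefficient e n (z t) ⬝ᵥ coefficient e n (z t)
      ≤ ∑ n ∈ Finset.range N, C n * Real.exp (-(2 * δ * t)) * ‖z₀‖ ^ 2 := by
        refine Finset.sum_le_sum fun n hn => ?_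
        have hdec := hCdecay n (fun t => coefficient e n (z t))
          ((continuous_coefficient e n).comp_continuousOn hz.continuousOn) (fun t ht => ?_) t ht
        · refine hdec.trans ?_
          simp only [hz.initial]
          exact mul_le_mul_of_nonneg_left (hbessel n) (mul_nonneg (hC n).le hexp)
        · obtain ⟨zt, hder, hcoef⟩ := hz.exists_hasDerivAt hL hγ hφ he hb ht
          refine (hasDerivAt_coefficient e n hder).congr_deriv ?_
          have hin := inner_controlProfile hL he hb
            (gain L d Q lam φ b Tbar (J * P⁻¹) *ᵥ modes N φ (z t)) ⟨n, Finset.mem_range.1 hn⟩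
          rw [projMatrix_mulVec_gain hB] at hin
          simp only [modes_eq_coefficient hL he] at hin
          rw [hcoef n, add_mulVec, ← mulVec_mulVec, hin]
          congr 2
          ext j
          rw [Subsingleton.elim j 0]
    _ = (∑ n ∈ Finset.range N, C n) * (Real.exp (-(2 * δ * t)) * ‖z₀‖ ^ 2) := by
        rw [Finset.sum_mul]
        exact Finset.sum_congr rfl fun n _ => by ring
    _ ≤ (1 + ∑ n ∈ Finset.range N, C n) * Real.exp (-(2 * δ * t)) * ‖z₀‖ ^ 2 := by
        have := mul_nonneg hexp hz0
        linarith

/-- The differential inequality for the energy of the modes `n ≥ N`. -/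
lemma inner_sub_lowModes_le {e : HilbertBasis ℕ ℝ (ScalarSpace L)} {ε : ℝ} (hε : 0 < ε)
    (hd : ∀ i, 0 < d i) (hlam : Monotone lam)
    (hneg : ∀ x : Fin m → ℝ, ε * (x ⬝ᵥ x) ≤
      x ⬝ᵥ (-(-(lam N • Matrix.diagonal d) + symPart Q + δ • 1) *ᵥ x))
    {f f' : StateSpace m L} {g : ScalarSpace L}
    (h : ∀ n, coefficient e n f' = (Q - lam n • Matrix.diagonal d) *ᵥ coefficient e n f +
      colB m *ᵥ fun _ => inner ℝ (e n) g) :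
    inner ℝ f f' - ∑ n ∈ Finset.range N, coefficient e n f ⬝ᵥ coefficient e n f' ≤
      -(δ + ε / 2) *
        (‖f‖ ^ 2 - ∑ n ∈ Finset.range N, coefficient e n f ⬝ᵥ coefficient e n f) +
      (2 * ε)⁻¹ * ‖g‖ ^ 2 := by
  have s1 := (hasSum_nat_add_iff' N).2 (hasSum_coefficient e f f')
  have s2 := (hasSum_nat_add_iff' N).2 (hasSum_coefficient e f f)
  have s3 : HasSum (fun n => inner ℝ (e n) g ^ 2) (‖g‖ ^ 2) := by
    have := e.hasSum_inner_mul_inner g g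
    rw [real_inner_self_eq_norm_sq] at this
    simpa [sq, real_inner_comm] using this
  have s4 := (hasSum_nat_add_iff' N).2 s3
  rw [real_inner_self_eq_norm_sq] at s2
  have hle := hasSum_le (fun n => ?_) s1
    ((s2.mul_left (-(δ + ε / 2))).add (s4.mul_left (2 * ε)⁻¹))
  · refine hle.trans (add_le_add le_rfl (mul_le_mul_of_nonneg_left ?_ (by positivity)))
    exact sub_le_self _ (Finset.sum_nonneg fun n _ => sq_nonneg _)
  · rw [h (n + N)]
    exact dotProduct_highMode_le hε hd hneg (hlam (Nat.le_add_left N n)) _ _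

/-- Exponential decay of a function obeying `W' ≤ -(2δ + ε) W + c e^{-2δt}`. -/
lemma le_of_deriv_le_add_exp {W W' : ℝ → ℝ} {ε c : ℝ} (hε : 0 < ε) (hc : 0 ≤ c)
    (hW : ContinuousOn W (Set.Ici 0)) (hd : ∀ t, 0 < t → HasDerivAt W (W' t) t)
    (hW0 : 0 ≤ W 0)
    (hle : ∀ t, 0 < t → W' t ≤ -(2 * δ + ε) * W t + c * Real.exp (-(2 * δ * t))) {t : ℝ}
    (ht : 0 ≤ t) : W t ≤ (W 0 + c / ε) * Real.exp (-(2 * δ * t)) := by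
  have he : ∀ t, HasDerivAt (fun t => Real.exp (2 * δ * t)) (2 * δ * Real.exp (2 * δ * t)) t :=
    fun t => by
      have := ((hasDerivAt_id t).const_mul (2 * δ)).exp
      simpa [mul_comm] using this
  have hee : ∀ t, Real.exp (2 * δ * t) * Real.exp (-(2 * δ * t)) = 1 := fun t => by
    rw [← Real.exp_add, add_neg_cancel, Real.exp_zero]
  have key := le_exp_mul_of_deriv_le (f := fun t => Real.exp (2 * δ * t) * W t - c / ε) (c := ε)
    (((Continuous.continuousOn (by fun_prop)).mul hW).sub continuousOn_const)
    (fun t ht => ((he t).mul (hd t ht)).sub_const _)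
    (fun t ht => by
      have h1 := mul_le_mul_of_nonneg_left (hle t ht) (Real.exp_pos (2 * δ * t)).le
      have h2 : ε * (c / ε) = c := by field_simp
      linear_combination h1 + c * hee t - h2) ht
  simp only [mul_zero, Real.exp_zero, one_mul] at key
  have hexp1 : Real.exp (-(ε * t)) ≤ 1 := Real.exp_le_one_iff.2 (by nlinarith)
  have hexp0 := Real.exp_pos (-(ε * t))
  have hcε : 0 ≤ c / ε := by positivity
  have h3 : Real.exp (2 * δ * t) * W t ≤ W 0 + c / ε := by nlinarith
  have h4 := mul_le_mul_of_nonneg_right h3 (Real.exp_pos (-(2 * δ * t))).le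
  linear_combination h4 - W t * hee t

/-- Exponential stability of the closed loop. -/
theorem exists_closedLoop_decay (hL : 0 < L) (hγ : ∀ i, γ i 0 ^ 2 + γ i 1 ^ 2 ≠ 0)
    (hd : ∀ i, 0 < d i) (hφ : IsEigensystem L γ lam φ)
    (hb : ∀ j, MemLp (b j) 2 (volume.restrict (Set.Ioo 0 L)))
    (hB : IsUnit (projMatrix L φ b).det)
    (hN : NegDef (-(lam N • Matrix.diagonal d) + symPart Q + δ • 1))
    (hT : SolvesSylvester d Q Tbar)
    {P : Matrix (Fin m) (Fin m) ℝ} {J : Matrix (Fin 1) (Fin m) ℝ} (hP : P.PosDef)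
    (hJ : DesignLMI d Q δ (lam 0) P J) :
    ∃ ℓ : ℝ, 0 < ℓ ∧ ∀ (z₀ : StateSpace m L) (z : ℝ → StateSpace m L),
      IsSolution γ d Q b
        (fun t => gain L d Q lam φ b Tbar (J * P⁻¹) *ᵥ modes N φ (z t)) z₀ z →
      ∀ t : ℝ, 0 ≤ t → ‖z t‖ ≤ ℓ * Real.exp (-(δ * t)) * ‖z₀‖ := by
  obtain ⟨e, he⟩ := hφ.exists_hilbertBasis hL hγ
  obtain ⟨C₁, hC₁, hlow⟩ := exists_lowMode_decay hL.le hγ hd hφ he hb hB hT hP hJ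
  obtain ⟨C₂, hC₂, hctl⟩ := exists_controlProfile_le (m := m) hL.le he hb
    (gain L d Q lam φ b Tbar (J * P⁻¹))
  obtain ⟨ε, hε, hcoer⟩ := exists_mul_dotProduct_le (continuous_quadForm _) (quadForm_smul _)
    fun x hx => posDef_quadForm_pos hN hx
  set A := 1 + C₂ * C₁ / ε / ε + C₁ with hA
  have hApos : 0 < A := by positivity
  refine ⟨Real.sqrt A, Real.sqrt_pos.2 hApos, fun z₀ z hz t ht => ?_⟩
  have hnonneg : ∀ n f, 0 ≤ coefficient (m := m) e n f ⬝ᵥ coefficient e n f := fun n f =>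
    Finset.sum_nonneg fun i _ => mul_self_nonneg _
  let W : ℝ → ℝ := fun t =>
    ‖z t‖ ^ 2 - ∑ n ∈ Finset.range N, coefficient e n (z t) ⬝ᵥ coefficient e n (z t)
  have hW0 : W 0 ≤ ‖z₀‖ ^ 2 := by
    simp only [W, hz.initial]
    exact sub_le_self _ (Finset.sum_nonneg fun n _ => hnonneg n _)
  have hW0' : 0 ≤ W 0 := by
    refine sub_nonneg.2 ?_
    rw [← real_inner_self_eq_norm_sq]
    exact sum_le_hasSum _ (fun n _ => hnonneg n _) (hasSum_coefficient e (z 0) (z 0))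
  have hWc : ContinuousOn W (Set.Ici 0) := by
    refine (hz.continuousOn.norm.pow 2).sub (continuousOn_finsetSum _ fun n _ => ?_)
    have hc := (continuous_coefficient (m := m) e n).comp_continuousOn hz.continuousOn
    have hdot : Continuous fun x : Fin m → ℝ => x ⬝ᵥ x := by fun_prop
    exact hdot.comp_continuousOn hc
  have hWd : ∀ t, 0 < t → ∃ W' : ℝ, HasDerivAt W W' t ∧
      W' ≤ -(2 * δ + ε) * W t + C₂ * C₁ / ε * ‖z₀‖ ^ 2 * Real.exp (-(2 * δ * t)) := by
    intro t ht
    obtain ⟨zt, hder, hcoef⟩ := hz.exists_hasDerivAt hL.le hγ hφ he hb ht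
    have hin := inner_sub_lowModes_le hε hd hφ.strictMono.monotone hcoer hcoef
    refine ⟨_, hder.norm_sq.sub (HasDerivAt.fun_sum fun n _ => hasDerivAt_dotProduct
      (hasDerivAt_coefficient e n hder) (hasDerivAt_coefficient e n hder)), ?_⟩
    have hu := (hctl (z t)).trans (mul_le_mul_of_nonneg_left (hlow z₀ z hz t ht.le) hC₂.le)
    have hu' := mul_le_mul_of_nonneg_left hu (inv_pos.2 hε).le
    have hsum : ∑ n ∈ Finset.range N, (coefficient e n zt ⬝ᵥ coefficient e n (z t) +
        coefficient e n (z t) ⬝ᵥ coefficient e n zt) =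
        2 * ∑ n ∈ Finset.range N, coefficient e n (z t) ⬝ᵥ coefficient e n zt := by
      rw [Finset.mul_sum]
      exact Finset.sum_congr rfl fun n _ => by
        rw [dotProduct_comm (coefficient e n zt)]; ring
    rw [hsum]
    have e1 : ε⁻¹ * (C₂ * (C₁ * Real.exp (-(2 * δ * t)) * ‖z₀‖ ^ 2)) =
        C₂ * C₁ / ε * ‖z₀‖ ^ 2 * Real.exp (-(2 * δ * t)) := by
      field_simp
    rw [← e1]
    rw [mul_inv] at hin
    simp only [W]
    linarith
  choose! W' hW' hW'le using hWd
  have hWt := le_of_deriv_le_add_exp hε (by positivity) hWc hW' hW0' hW'le ht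
  have hlowt := hlow z₀ z hz t ht
  have hexp := Real.exp_pos (-(2 * δ * t))
  have htotal : ‖z t‖ ^ 2 ≤ A * Real.exp (-(2 * δ * t)) * ‖z₀‖ ^ 2 := by
    have h1 := mul_le_mul_of_nonneg_right hW0 hexp.le
    have e1 : C₂ * C₁ / ε * ‖z₀‖ ^ 2 / ε = C₂ * C₁ / ε / ε * ‖z₀‖ ^ 2 := by ring
    rw [e1] at hWt
    simp only [W] at hWt h1
    rw [hA]
    linarith
  have hsq : (Real.sqrt A * Real.exp (-(δ * t)) * ‖z₀‖) ^ 2 =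
      A * Real.exp (-(2 * δ * t)) * ‖z₀‖ ^ 2 := by
    rw [mul_pow, mul_pow, Real.sq_sqrt hApos.le, ← Real.exp_nat_mul]
    congr 3
    push_cast
    ring
  exact le_of_sq_le_sq (by rw [hsq]; exact htotal) (by positivity)

end ClosedLoop

end ParabolicStabilization

end

theorem theorem1 (m : ℕ) [NeZero m] (L : ℝ) (hL : 0 < L)
    (γ : Matrix (Fin 2) (Fin 2) ℝ) (hγ : ∀ i, γ i 0 ^ 2 + γ i 1 ^ 2 ≠ 0)
    (d : Fin m → ℝ) (hd : ∀ i, 0 < d i)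
    (Q : Matrix (Fin m) (Fin m) ℝ) (hQ : ParabolicStabilization.IsReactionMatrix Q)
    (hctrl : ParabolicStabilization.SubdiagonalNonzero Q)
    (lam : ℕ → ℝ) (φ : ℕ → ℝ → ℝ) (hφ : ParabolicStabilization.IsEigensystem L γ lam φ)
    (δ : ℝ) (hδ : 0 < δ) :
    (∀ (N : ℕ) (b : Fin N → ℝ → ℝ),
      (∀ j, MemLp (b j) 2 (volume.restrict (Set.Ioo 0 L))) →
      IsUnit (ParabolicStabilization.projMatrix L φ b).det →
      ParabolicStabilization.NegDef
        (-(lam N • Matrix.diagonal d) + ParabolicStabilization.symPart Q + δ • 1) →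
      ∀ Tbar : ℕ → Matrix (Fin m) (Fin m) ℝ,
      ParabolicStabilization.SolvesSylvester d Q Tbar →
      ∀ (P : Matrix (Fin m) (Fin m) ℝ) (J : Matrix (Fin 1) (Fin m) ℝ), P.PosDef →
      ParabolicStabilization.DesignLMI d Q δ (lam 0) P J →
      ∃ ℓ : ℝ, 0 < ℓ ∧
        ∀ (z₀ : ParabolicStabilization.StateSpace m L)
          (z : ℝ → ParabolicStabilization.StateSpace m L),
          ParabolicStabilization.IsSolution γ d Q b
            (fun t => (ParabolicStabilization.gain L d Q lam φ b Tbar (J * P⁻¹)).mulVec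
              (ParabolicStabilization.modes N φ (z t))) z₀ z →
          ∀ t : ℝ, 0 ≤ t → ‖z t‖ ≤ ℓ * Real.exp (-(δ * t)) * ‖z₀‖) ∧
    (∃ (P : Matrix (Fin m) (Fin m) ℝ) (J : Matrix (Fin 1) (Fin m) ℝ), P.PosDef ∧
      ParabolicStabilization.DesignLMI d Q δ (lam 0) P J) := by
  exact ⟨fun N b hb hB hN Tbar hT P J hP hJ =>
      ParabolicStabilization.exists_closedLoop_decay hL hγ hd hφ hb hB hN hT hP hJ,
    ParabolicStabilization.exists_designLMI d hQ hctrl δ (lam 0)⟩
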